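/- Throughout, $n\ge 1$ is an integer, cubes $Q\subset\mathbb R^n$ have positive finite side length and sides parallel to the axes, and $|Q|$ is the Lebesgue measure of $Q$. A *weight* is a non-negative measurable function $\mathbb R^n\to[0,\infty)$ that is positive on a set of positive measure. A locally integrable $b:\mathbb R^n\to\mathbb R$ is in $BMO$ if $\|b\|_{BMO}=\sup_Q \frac1{|Q|}\int_Q |b(x)-b_Q|\,dx<\infty$, where $b_Q=\frac1{|Q|}\int_Q b(y)\,dy$. For $0<\alpha<n$ let $$I_\alpha f(x)=\int_{\mathbb R^n}\frac{f(y)}{|x-y|^{n-\alpha}}\,dy,\qquad [b,I_\alpha]f(x)=b(x)I_\alpha f(x)-I_\alpha(bf)(x)$$ at every $x$ where both integrals converge absolutely. For a function $\Phi:[0,\infty)\to[0,\infty)$ let $\|f\|_{\Phi,Q}=\inf\{\lambda>0: \frac1{|Q|}\int_Q\Phi(|f(x)|/\lambda)\,dx\le 1\}$ ($=\infty$ if there is no such $\lambda$). For $1<p\le q<\infty$, $p'=p/(p-1)$, and weights $u,\sigma$ let $$[u,\sigma]_{A^\alpha_{p,q,A,B}}=\sup_Q |Q|^{\frac{\alpha}{n}+\frac1q-\frac1p}\,\|u^{1/q}\|_{A,Q}\,\|\sigma^{1/p'}\|_{B,Q}.$$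 **Theorem.** Let $0<\alpha<n$, $1<p\le q<\infty$ and $\delta>0$, and put $$A(t)=t^q\log(e+t)^{2q-1+\delta},\qquad B(t)=t^{p'}\log(e+t)^{2p'-1+\delta}.$$ There is a constant $C$, depending only on $n,\alpha,p,q,\delta$, such that the following holds for every $b\in BMO$ and every pair of weights $(u,\sigma)$ with $[u,\sigma]_{A^\alpha_{p,q,A,B}}<\infty$. For every $f\in L^p(\sigma)$ (that is, $f:\mathbb R^n\to\mathbb R$ with $\int|f|^p\sigma\,dx<\infty$), the integrals defining $I_\alpha(f\sigma)(x)$ and $I_\alpha(bf\sigma)(x)$ converge absolutely for $u\,dx$-almost every $x$, the function $[b,I_\alpha](f\sigma)$ belongs to $L^q(u)$, and $$\Big(\int_{\mathbb R^n}|[b,I_\alpha](f\sigma)(x)|^q\,u(x)\,dx\Big)^{1/q}\le C\,\|b\|_{BMO}\,[u,\sigma]_{A^\alpha_{p,q,A,B}}\Big(\int_{\mathbb R^n}|f(x)|^p\sigma(x)\,dx\Big)^{1/p}.$$ -/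

import Mathlib

open MeasureTheory

open scoped ENNReal NNReal

noncomputable section

namespace FracComm

/-- The (half-open) cube with sides parallel to the axes, lower corner `a` and side length `l`.
Only cubes with `0 < l` are used. -/
def cube {n : ℕ} (a : EuclideanSpace ℝ (Fin n)) (l : ℝ) : Set (EuclideanSpace ℝ (Fin n)) :=
  {x | ∀ i, x i ∈ Set.Ico (a i) (a i + l)}

/-- A weight: a non-negative (Lebesgue) measurable function that is positive on a set of positive
measure. -/
structure IsWeight {n : ℕ} (w : EuclideanSpace ℝ (Fin n) → ℝ) : Prop where
  aemeasurable : AEMeasurable w volume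
  nonneg : ∀ x, 0 ≤ w x
  pos : 0 < volume {x | 0 < w x}

/-- The measure `w dx`. -/
def weightMeasure {n : ℕ} (w : EuclideanSpace ℝ (Fin n) → ℝ) :
    Measure (EuclideanSpace ℝ (Fin n)) :=
  volume.withDensity fun x => ENNReal.ofReal (w x)

/-- `‖b‖_BMO`, the supremum over all cubes `Q` of the average over `Q` of `|b - b_Q|`, where
`b_Q` is the average of `b` over `Q`. -/
def bmoNorm {n : ℕ} (b : EuclideanSpace ℝ (Fin n) → ℝ) : ℝ≥0∞ :=
  ⨆ (a : EuclideanSpace ℝ (Fin n)) (l : ℝ) (_ : 0 < l),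
    ⨍⁻ x in cube a l, ‖b x - ⨍ y in cube a l, b y ∂volume‖ₑ ∂volume

/-- `b` is a (real-valued) function of bounded mean oscillation. -/
structure IsBMO {n : ℕ} (b : EuclideanSpace ℝ (Fin n) → ℝ) : Prop where
  locallyIntegrable : LocallyIntegrable b volume
  bmoNorm_lt_top : bmoNorm b < ∞

/-- The integrand `y ↦ f(y) / |x - y|^(n - α)` of the fractional integral of `f` at `x`. -/
def fracIntegrand {n : ℕ} (α : ℝ) (f : EuclideanSpace ℝ (Fin n) → ℝ)
    (x y : EuclideanSpace ℝ (Fin n)) : ℝ :=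
  f y / ‖x - y‖ ^ ((n : ℝ) - α)

/-- The fractional integral `I_α f (x)`. -/
def fracIntegral {n : ℕ} (α : ℝ) (f : EuclideanSpace ℝ (Fin n) → ℝ)
    (x : EuclideanSpace ℝ (Fin n)) : ℝ :=
  ∫ y, fracIntegrand α f x y

/-- The commutator `[b, I_α] f (x) = b(x) I_α f (x) - I_α (b f) (x)`. -/
def commutator {n : ℕ} (b : EuclideanSpace ℝ (Fin n) → ℝ) (α : ℝ)
    (f : EuclideanSpace ℝ (Fin n) → ℝ) (x : EuclideanSpace ℝ (Fin n)) : ℝ :=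
  b x * fracIntegral α f x - fracIntegral α (fun y => b y * f y) x

/-- The normalized Luxemburg norm `‖f‖_{Φ,Q}`, the infimum of all `lam > 0` such that the average
of `Φ(|f| / lam)` over `Q` is at most `1` (it is `∞` if there is no such `lam`). -/
def luxNorm {n : ℕ} (Φ : ℝ → ℝ) (Q : Set (EuclideanSpace ℝ (Fin n)))
    (f : EuclideanSpace ℝ (Fin n) → ℝ) : ℝ≥0∞ :=
  ⨅ (lam : ℝ) (_ : 0 < lam) (_ : ⨍⁻ x in Q, ENNReal.ofReal (Φ (|f x| / lam)) ∂volume ≤ 1),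
    ENNReal.ofReal lam

/-- The conjoined bump constant `[u, σ]_{A^α_{p,q,A,B}}`, the supremum over all cubes `Q` of
`|Q|^(α/n + 1/q - 1/p) ‖u^(1/q)‖_{A,Q} ‖σ^(1/p')‖_{B,Q}`, where `p' = p / (p - 1)`. -/
def bumpConst {n : ℕ} (α p q : ℝ) (A B : ℝ → ℝ) (u σ : EuclideanSpace ℝ (Fin n) → ℝ) : ℝ≥0∞ :=
  ⨆ (a : EuclideanSpace ℝ (Fin n)) (l : ℝ) (_ : 0 < l),
    volume (cube a l) ^ (α / n + 1 / q - 1 / p) *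
      luxNorm A (cube a l) (fun x => u x ^ (1 / q)) *
      luxNorm B (cube a l) (fun x => σ x ^ (1 / Real.conjExponent p))

/-- The log bump `t ↦ t^r log(e + t)^(2r - 1 + δ)`, for `t ≥ 0`. -/
def logBump (r δ t : ℝ) : ℝ :=
  t ^ r * Real.log (Real.exp 1 + t) ^ (2 * r - 1 + δ)

end FracComm

end

/-! ### Cubes and dyadic grids -/

noncomputable section

namespace FracComm

variable {n : ℕ}

local notation "E" => EuclideanSpace ℝ (Fin n)

/-! After scaling `b`, everything is controlled by the positive operator `commMajorant` with kernel
`(1 + |b x - b y|) / |x - y|^(n-α)`. The summand 1 makes its finiteness yield absolute convergence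
of both integrals, and the oscillation bounds the commutator. By duality it suffices to bound the
double integral of this kernel against `F y * G x`, with `F = h w` and `G = g v`. Here `h = |f|
σ^(1/p)` is in `L^r`, `w = σ^(1/p')`, `v = u^(1/q)`, `g` is in `L^s`, and `r = p`, `s = q'`.

The one-third trick (`exists_idx_thirdGrid_eq`) puts any two points at distance in `[2^(-N), 2^N]`
into a common cell of comparable size in one of finitely many grids. Passing through the average of
`b` on that cell splits the kernel into two dyadic forms, exchanged by the symmetry of the
hypotheses (`Admissible.symm`). In each the oscillation of `b` falls on one function and the other
function is averaged.

A dyadic form is handled by stopping cells, where the average of `G` has more than doubled. Before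
stopping, this average is essentially constant and the sum over levels is a convergent series
dominated by its first term (`exists_sum_len_rpow_le`), since cell averages of a `BMO` function
drift only linearly in the level. On one cell, a three-factor Hölder inequality
(`exists_lintegral_le_luxNorm_mul_luxNorm`) pairs the exponential integrability of `b`
(John–Nirenberg) with the log bump of the weight and a complementary norm of `h`. The factor `b`
costs one logarithm, whence the exponent `2r - 1 + δ` in place of `r - 1 + δ`. The bump condition
removes the weights. The stopping cells fill at most half of their parent, so what remains is
bounded by an integral of Orlicz maximal functions of `h` and `g`. These are bounded on `L^r` and
`L^s` (`exists_lintegral_luxMax_rpow_le`) because `δ > 0`, and Hölder's inequality concludes. -/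

theorem cube_eq_preimage (a : E) (l : ℝ) :
    cube a l = (MeasurableEquiv.toLp 2 (Fin n → ℝ)).symm ⁻¹'
      (Set.univ.pi fun i => Set.Ico (a i) (a i + l)) := by
  ext x
  simp [cube, Set.mem_pi]

theorem measurableSet_cube (a : E) (l : ℝ) : MeasurableSet (cube a l) := by
  rw [cube_eq_preimage]
  exact (MeasurableEquiv.measurable _)
    (MeasurableSet.univ_pi fun i => measurableSet_Ico)

theorem volume_cube (a : E) (l : ℝ) :
    volume (cube a l) = ENNReal.ofReal l ^ n := by
  rw [cube_eq_preimage, (EuclideanSpace.volume_preserving_symm_measurableEquiv_toLp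
    (Fin n)).measure_preimage
    (MeasurableSet.univ_pi fun i => measurableSet_Ico).nullMeasurableSet, Real.volume_pi_Ico]
  simp

/-- A dyadic grid: the cells of level `k` are the half-open cubes of side length `side / 2 ^ k`
with a corner at `origin`, and their translates by multiples of the side length. -/
structure Grid (n : ℕ) where
  side : ℝ
  origin : Fin n → ℝ
  side_pos : 0 < side

namespace Grid

variable (D : Grid n)

/-- The side length of the cells of level `k`. -/
def len (k : ℕ) : ℝ := D.side / 2 ^ k

/-- The index of the cell of level `k` that contains `x`. -/
def idx (k : ℕ) (x : E) : Fin n → ℤ := fun i => ⌊(x i - D.origin i) / D.len k⌋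

/-- The cell of level `k` that contains `x`. -/
def cell (k : ℕ) (x : E) : Set E := {y | D.idx k y = D.idx k x}

/-- The lower corner of the cell of level `k` that contains `x`. -/
def corner (k : ℕ) (x : E) : E :=
  WithLp.toLp 2 fun i => D.origin i + D.idx k x i * D.len k

theorem len_pos (k : ℕ) : 0 < D.len k := div_pos D.side_pos (by positivity)

theorem len_add (k j : ℕ) : D.len (k + j) = D.len k / 2 ^ j := by
  rw [len, len, pow_add, div_div]

theorem cell_eq_cube (k : ℕ) (x : E) : D.cell k x = cube (D.corner k x) (D.len k) := by
  ext y
  simp only [cell, cube, Set.mem_ofPred_eq, funext_iff, corner, Set.mem_Ico]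
  refine forall_congr' fun i => ?_
  have hl := D.len_pos k
  change ⌊(y i - D.origin i) / D.len k⌋ = D.idx k x i ↔ _
  rw [Int.floor_eq_iff, le_div_iff₀ hl, div_lt_iff₀ hl]
  constructor <;> rintro ⟨h1, h2⟩ <;> constructor <;> nlinarith

theorem measurable_idx (k : ℕ) : Measurable (D.idx k : E → Fin n → ℤ) := by
  refine measurable_pi_lambda _ fun i => ?_
  have : Measurable fun x : E => x i := by fun_prop
  exact Int.measurable_floor.comp ((this.sub_const _).div_const _)

theorem idx_mono {j k : ℕ} (h : j ≤ k) {x y : E} (hxy : D.idx k x = D.idx k y) :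
    D.idx j x = D.idx j y := by
  obtain ⟨i, rfl⟩ := Nat.exists_eq_add_of_le h
  -- Integer division by `2 ^ i` turns the fine index into the coarse one, which gives nesting.
  have key : ∀ z : E, ∀ m, D.idx j z m = D.idx (j + i) z m / ((2 ^ i : ℕ) : ℤ) := by
    intro z m
    simp only [idx]
    rw [← Int.floor_div_natCast, len_add]
    congr 1
    have := (D.len_pos j).ne'
    push_cast
    field_simp
  funext m
  rw [key, key, hxy]

theorem mem_cell_self (k : ℕ) (x : E) : x ∈ D.cell k x := rfl

theorem measurableSet_cell (k : ℕ) (x : E) : MeasurableSet (D.cell k x) := by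
  rw [cell_eq_cube]; exact measurableSet_cube _ _

theorem cell_subset {j k : ℕ} (h : j ≤ k) (x : E) : D.cell k x ⊆ D.cell j x :=
  fun _ hy => D.idx_mono h hy

theorem cell_eq {k : ℕ} {x y : E} (h : y ∈ D.cell k x) : D.cell k y = D.cell k x := by
  ext z
  simp only [cell, Set.mem_ofPred_eq] at h ⊢
  rw [h]

theorem volume_cell (k : ℕ) (x : E) : volume (D.cell k x) = ENNReal.ofReal (D.len k) ^ n := by
  rw [cell_eq_cube, volume_cube]

theorem volume_cell_ne_zero (k : ℕ) (x : E) : volume (D.cell k x) ≠ 0 := by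
  rw [volume_cell]
  exact pow_ne_zero _ (by simpa using D.len_pos k)

theorem volume_cell_ne_top (k : ℕ) (x : E) : volume (D.cell k x) ≠ ∞ := by
  rw [volume_cell]
  exact ENNReal.pow_ne_top ENNReal.ofReal_ne_top

theorem volume_cell_succ (k : ℕ) (x : E) :
    volume (D.cell k x) = 2 ^ n * volume (D.cell (k + 1) x) := by
  rw [volume_cell, volume_cell, ← mul_pow]
  congr 1
  rw [len_add, pow_one, ← ENNReal.ofReal_ofNat, ← ENNReal.ofReal_mul (by norm_num)]
  congr 1
  ring

/-! ### Unions of cells and stopping arguments -/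

/-- The set `A` is a union of cells of level `k`. -/
def Saturated (k : ℕ) (A : Set E) : Prop := ∀ ⦃x y⦄, D.idx k x = D.idx k y → x ∈ A → y ∈ A

variable {D}

theorem Saturated.mono {j k : ℕ} {A : Set E} (h : D.Saturated j A) (hjk : j ≤ k) :
    D.Saturated k A := fun _ _ hxy hx => h (D.idx_mono hjk hxy) hx

theorem Saturated.eq_preimage {k : ℕ} {A : Set E} (h : D.Saturated k A) :
    A = D.idx k ⁻¹' (D.idx k '' A) := by
  ext x
  simp only [Set.mem_preimage, Set.mem_image]
  exact ⟨fun hx => ⟨x, hx, rfl⟩, fun ⟨y, hy, hyx⟩ => h hyx hy⟩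

theorem Saturated.measurableSet {k : ℕ} {A : Set E} (h : D.Saturated k A) : MeasurableSet A := by
  rw [h.eq_preimage]
  exact D.measurable_idx k (Set.to_countable _).measurableSet

theorem Saturated.cell_subset {k : ℕ} {A : Set E} (h : D.Saturated k A) {x : E} (hx : x ∈ A) :
    D.cell k x ⊆ A := fun _ hy => h (Eq.symm hy) hx

theorem saturated_cell (k : ℕ) (x : E) : D.Saturated k (D.cell k x) :=
  fun _ _ h hy => h.symm.trans hy

theorem Saturated.lintegral_eq_tsum {k : ℕ} {A : Set E} (h : D.Saturated k A) (φ : E → ℝ≥0∞) :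
    ∫⁻ x in A, φ x = ∑' m : D.idx k '' A, ∫⁻ x in D.idx k ⁻¹' {m.1}, φ x := by
  rw [← lintegral_iUnion]
  · congr 2
    ext x
    simp only [Set.mem_iUnion, Set.mem_preimage, Set.mem_singleton_iff, Subtype.exists,
      Set.mem_image, exists_prop]
    exact ⟨fun hx => ⟨_, ⟨x, hx, rfl⟩, rfl⟩, fun ⟨_, ⟨y, hy, e⟩, e'⟩ => h (e.trans e'.symm) hy⟩
  · exact fun m => D.measurable_idx k (measurableSet_singleton _)
  · intro m m' hm
    refine Set.disjoint_left.2 fun x hx hx' => hm (Subtype.ext ?_)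
    exact (show D.idx k x = m.1 from hx).symm.trans hx'

theorem Saturated.lintegral_le {k : ℕ} {A : Set E} (h : D.Saturated k A) {φ ψ : E → ℝ≥0∞}
    (H : ∀ x ∈ A, ∫⁻ y in D.cell k x, φ y ≤ ∫⁻ y in D.cell k x, ψ y) :
    ∫⁻ x in A, φ x ≤ ∫⁻ x in A, ψ x := by
  rw [h.lintegral_eq_tsum, h.lintegral_eq_tsum]
  refine ENNReal.tsum_le_tsum fun m => ?_
  obtain ⟨m, x, hx, rfl⟩ := m
  exact H x hx

/-- The sets removed are unions of coarser cells, so only whole cells of level `j` disappear. What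
is left consists of the maximal stopping cells of level `j`. -/
theorem Saturated.disjointed {B : ℕ → Set E} (hB : ∀ j, D.Saturated j (B j)) (j : ℕ) :
    D.Saturated j (disjointed B j) := by
  intro x y hxy hx
  rw [disjointed_apply] at hx ⊢
  refine ⟨hB j hxy hx.1, fun hy => hx.2 ?_⟩
  simp only [Finset.sup_set_eq_biUnion, Set.mem_iUnion] at hy ⊢
  obtain ⟨i, hi, hy⟩ := hy
  exact ⟨i, hi, (hB i).mono (Finset.mem_Iio.1 hi).le hxy.symm hy⟩

theorem not_mem_of_mem_disjointed {B : ℕ → Set E} {i j : ℕ} (hij : i < j) {x : E}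
    (hx : x ∈ _root_.disjointed B j) : x ∉ B i := by
  rw [disjointed_apply] at hx
  exact fun h => hx.2 (by
    simp only [Finset.sup_set_eq_biUnion, Set.mem_iUnion]
    exact ⟨i, Finset.mem_Iio.2 hij, h⟩)

theorem lintegral_iUnion_saturated {B : ℕ → Set E} (hB : ∀ j, D.Saturated j (B j))
    (φ : E → ℝ≥0∞) :
    ∫⁻ x in ⋃ j, B j, φ x = ∑' j, ∫⁻ x in _root_.disjointed B j, φ x := by
  rw [← iUnion_disjointed, lintegral_iUnion]
  · exact fun j => (Saturated.disjointed hB j).measurableSet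
  · exact disjoint_disjointed B

/-- Chebyshev's inequality summed over the maximal cells, which are disjoint; no covering constant
is lost. -/
theorem mul_volume_iUnion_le {B : ℕ → Set E} (hB : ∀ j, D.Saturated j (B j)) {g : E → ℝ≥0∞}
    {t : ℝ≥0∞} (H : ∀ j, ∀ x ∈ B j, t * volume (D.cell j x) ≤ ∫⁻ y in D.cell j x, g y) :
    t * volume (⋃ j, B j) ≤ ∫⁻ y in ⋃ j, B j, g y := by
  rw [← setLIntegral_const, lintegral_iUnion_saturated hB, lintegral_iUnion_saturated hB]
  refine ENNReal.tsum_le_tsum fun j => (Saturated.disjointed hB j).lintegral_le fun x hx => ?_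
  rw [setLIntegral_const]
  exact H j x (disjointed_subset B j hx)

/-- One step of a stopping argument: `a` pays for the levels before stopping, and `φ' j` is the same
quantity restarted in a stopping cell of level `j`, where an induction hypothesis supplies `h3`. It
serves both for John–Nirenberg and for the bilinear form. -/
theorem lintegral_stopping_le {B : ℕ → Set E} (hB : ∀ j, D.Saturated j (B j)) {P : Set E}
    (hP : MeasurableSet P) (hBP : ∀ j, B j ⊆ P) {φ : E → ℝ≥0∞} {φ' : ℕ → E → ℝ≥0∞}
    {a ψ : E → ℝ≥0∞} {c : ℝ≥0∞}
    (ha : AEMeasurable a) (hc : c ≠ ∞)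
    (h1 : ∀ x ∈ P, (∀ j, x ∉ B j) → φ x ≤ a x)
    (h2 : ∀ j, ∀ x ∈ B j, (∀ i < j, x ∉ B i) → φ x ≤ a x + c * φ' j x)
    (h3 : ∀ j, ∀ x ∈ B j, (∀ i < j, x ∉ B i) →
      ∫⁻ y in D.cell j x, φ' j y ≤ ∫⁻ y in D.cell j x, ψ y) :
    ∫⁻ x in P, φ x ≤ (∫⁻ x in P, a x) + c * ∫⁻ x in ⋃ j, B j, ψ x := by
  have hU : MeasurableSet (⋃ j, B j) := MeasurableSet.iUnion fun j => (hB j).measurableSet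
  have hsub : (⋃ j, B j) ⊆ P := Set.iUnion_subset hBP
  rw [← lintegral_inter_add_sdiff φ P hU, ← lintegral_inter_add_sdiff a P hU,
    Set.inter_eq_self_of_subset_right hsub]
  have e1 : ∫⁻ x in P \ ⋃ j, B j, φ x ≤ ∫⁻ x in P \ ⋃ j, B j, a x := by
    refine setLIntegral_mono' (hP.diff hU) fun x hx => h1 x hx.1 fun j hj => hx.2 ?_
    exact Set.mem_iUnion.2 ⟨j, hj⟩
  have e2 : ∫⁻ x in ⋃ j, B j, φ x ≤ (∫⁻ x in ⋃ j, B j, a x) + c * ∫⁻ x in ⋃ j, B j, ψ x := by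
    rw [lintegral_iUnion_saturated hB, lintegral_iUnion_saturated hB,
      lintegral_iUnion_saturated hB, ← ENNReal.tsum_mul_left, ← ENNReal.tsum_add]
    refine ENNReal.tsum_le_tsum fun j => ?_
    have hm := (Saturated.disjointed hB j).measurableSet
    calc ∫⁻ x in _root_.disjointed B j, φ x
        ≤ ∫⁻ x in _root_.disjointed B j, (a x + c * φ' j x) := by
          refine setLIntegral_mono' hm fun x hx => ?_
          exact h2 j x (disjointed_subset B j hx) fun i hi => not_mem_of_mem_disjointed hi hx
      _ = (∫⁻ x in _root_.disjointed B j, a x) + c * ∫⁻ x in _root_.disjointed B j, φ' j x := by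
          rw [lintegral_add_left' ha.restrict, lintegral_const_mul' _ _ hc]
      _ ≤ _ := by
          refine add_le_add le_rfl (mul_le_mul_right ?_ c)
          refine (Saturated.disjointed hB j).lintegral_le fun x hx => ?_
          exact h3 j x (disjointed_subset B j hx) fun i hi => not_mem_of_mem_disjointed hi hx
  calc _ ≤ ((∫⁻ x in ⋃ j, B j, a x) + c * ∫⁻ x in ⋃ j, B j, ψ x) +
        ∫⁻ x in P \ ⋃ j, B j, a x := add_le_add e2 e1
    _ = _ := by ring

end Grid

/-! ### Averages over cells and their convergence -/

theorem norm_le_sqrt_mul_of_forall_abs_le {z : E} {l : ℝ} (hl : 0 ≤ l) (h : ∀ i, |z i| ≤ l) :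
    ‖z‖ ≤ √n * l := by
  rw [EuclideanSpace.norm_eq]
  calc √(∑ i, ‖z i‖ ^ 2) ≤ √(∑ _i : Fin n, l ^ 2) :=
        Real.sqrt_le_sqrt (Finset.sum_le_sum fun i _ => pow_le_pow_left₀ (norm_nonneg _) (h i) 2)
    _ = √n * l := by
        rw [Finset.sum_const, Finset.card_univ, Fintype.card_fin, nsmul_eq_mul,
          Real.sqrt_mul (Nat.cast_nonneg _), Real.sqrt_sq hl]

namespace Grid

variable {D : Grid n}

theorem abs_sub_lt_of_mem_cell {k : ℕ} {x y : E} (h : y ∈ D.cell k x) (i : Fin n) :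
    |y i - x i| < D.len k := by
  have hx := D.mem_cell_self k x
  rw [cell_eq_cube] at h hx
  have h1 := h i
  have h2 := hx i
  simp only [Set.mem_Ico] at h1 h2
  rw [abs_lt]
  constructor <;> linarith

/-- The factor is `√n + 1` instead of `√n` so that the radius is positive even for `n = 0`, as
differentiation along balls requires. -/
theorem cell_subset_closedBall (k : ℕ) (x : E) :
    D.cell k x ⊆ Metric.closedBall x ((√n + 1) * D.len k) := by
  intro y hy
  rw [Metric.mem_closedBall, dist_eq_norm]
  refine (norm_le_sqrt_mul_of_forall_abs_le (D.len_pos k).le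
    fun i => (abs_sub_lt_of_mem_cell hy i).le).trans ?_
  have := D.len_pos k
  nlinarith

theorem integrableOn_cell {b : E → ℝ} (hb : LocallyIntegrable b) (k : ℕ) (x : E) :
    IntegrableOn b (D.cell k x) :=
  (hb.integrableOn_isCompact (isCompact_closedBall x _)).mono_set (cell_subset_closedBall k x)

theorem measurable_of_idx {β : Type*} [MeasurableSpace β] {f : E → β} (k : ℕ)
    (h : ∀ x y, D.idx k x = D.idx k y → f x = f y) : Measurable f := fun s _ =>
  Saturated.measurableSet (D := D) (k := k) fun x y hxy hx => by
    simpa only [Set.mem_preimage, ← h x y hxy] using hx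

variable (D) in
/-- The average of `b` over the cell of level `k` that contains `x`. -/
def avg (b : E → ℝ) (k : ℕ) (x : E) : ℝ := ⨍ y in D.cell k x, b y

theorem avg_congr (b : E → ℝ) {k : ℕ} {x y : E} (h : D.idx k x = D.idx k y) :
    D.avg b k x = D.avg b k y := by
  rw [avg, avg, D.cell_eq (show x ∈ D.cell k y from h)]

theorem measurable_avg (b : E → ℝ) (k : ℕ) : Measurable (D.avg b k) :=
  measurable_of_idx (D := D) k fun _ _ h => avg_congr b h

theorem volume_real_cell_pos (k : ℕ) (x : E) : 0 < volume.real (D.cell k x) :=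
  ENNReal.toReal_pos (D.volume_cell_ne_zero k x) (D.volume_cell_ne_top k x)

theorem avg_sub_const {b : E → ℝ} (hb : LocallyIntegrable b) (k : ℕ) (x : E) (c : ℝ) :
    volume.real (D.cell k x) * (D.avg b k x - c) = ∫ y in D.cell k x, (b y - c) := by
  have hfin : IsFiniteMeasure (volume.restrict (D.cell k x)) :=
    ⟨by simpa using (D.volume_cell_ne_top k x).lt_top⟩
  rw [integral_sub (integrableOn_cell hb k x) (integrable_const c), avg, setAverage_eq,
    setIntegral_const]
  have := (volume_real_cell_pos (D := D) k x).ne'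
  simp only [smul_eq_mul]
  field_simp

theorem enorm_avg_sub_mul_le {b : E → ℝ} (hb : LocallyIntegrable b) (k : ℕ) (x : E) (c : ℝ) :
    ‖D.avg b k x - c‖ₑ * volume (D.cell k x) ≤ ∫⁻ y in D.cell k x, ‖b y - c‖ₑ := by
  refine le_trans (le_of_eq ?_) (enorm_integral_le_lintegral_enorm _)
  rw [← avg_sub_const hb, enorm_mul, mul_comm,
    Real.enorm_of_nonneg (volume_real_cell_pos k x).le, Measure.real,
    ENNReal.ofReal_toReal (D.volume_cell_ne_top k x)]

theorem lintegral_sub_avg_le {b : E → ℝ} (hbmo : bmoNorm b ≤ 1) (k : ℕ) (x : E) :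
    ∫⁻ y in D.cell k x, ‖b y - D.avg b k x‖ₑ ≤ volume (D.cell k x) := by
  have h : ⨍⁻ y in cube (D.corner k x) (D.len k),
      ‖b y - ⨍ z in cube (D.corner k x) (D.len k), b z ∂volume‖ₑ ∂volume ≤ 1 :=
by
    refine le_trans ?_ hbmo
    refine le_iSup_of_le (D.corner k x) (le_iSup_of_le (D.len k) ?_)
    exact le_iSup (fun _ : 0 < D.len k => ⨍⁻ y in cube (D.corner k x) (D.len k),
      ‖b y - ⨍ z in cube (D.corner k x) (D.len k), b z ∂volume‖ₑ ∂volume) (D.len_pos k)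
  rw [← cell_eq_cube, setLAverage_eq, ENNReal.div_le_iff (D.volume_cell_ne_zero k x)
    (D.volume_cell_ne_top k x), one_mul] at h
  exact h

/-- A child fills the fraction `2 ^ (-n)` of its parent, so its mean oscillation about the parent's
average is at most `2 ^ n`. -/
theorem abs_avg_succ_sub_le {b : E → ℝ} (hb : LocallyIntegrable b) (hbmo : bmoNorm b ≤ 1)
    (k : ℕ) (x : E) : |D.avg b (k + 1) x - D.avg b k x| ≤ 2 ^ n := by
  have h1 := enorm_avg_sub_mul_le (D := D) hb (k + 1) x (D.avg b k x)
  have h2 : ∫⁻ y in D.cell (k + 1) x, ‖b y - D.avg b k x‖ₑ ≤ volume (D.cell k x) :=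
    (lintegral_mono_set (D.cell_subset k.le_succ x)).trans (lintegral_sub_avg_le hbmo k x)
  rw [volume_cell_succ] at h2
  have h3 := (ENNReal.mul_le_mul_iff_left (D.volume_cell_ne_zero (k + 1) x)
    (D.volume_cell_ne_top (k + 1) x)).1 (h1.trans h2)
  rw [Real.enorm_eq_ofReal_abs, ← ENNReal.ofReal_ofNat, ← ENNReal.ofReal_pow (by norm_num)] at h3
  exact (ENNReal.ofReal_le_ofReal_iff (by positivity)).1 h3

theorem abs_avg_add_sub_le {b : E → ℝ} (hb : LocallyIntegrable b) (hbmo : bmoNorm b ≤ 1)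
    (k j : ℕ) (x : E) : |D.avg b (k + j) x - D.avg b k x| ≤ j * 2 ^ n := by
  induction j with
  | zero => simp
  | succ j ih =>
    have h := abs_avg_succ_sub_le (D := D) hb hbmo (k + j) x
    calc _ ≤ |D.avg b (k + j + 1) x - D.avg b (k + j) x| + |D.avg b (k + j) x - D.avg b k x| :=
          abs_sub_le _ _ _
      _ ≤ 2 ^ n + j * 2 ^ n := add_le_add h ih
      _ = _ := by push_cast; ring

theorem ae_tendsto_avg {b : E → ℝ} (hb : LocallyIntegrable b) :
    ∀ᵐ x, Filter.Tendsto (fun k => D.avg b k x) Filter.atTop (nhds (b x)) := by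
  filter_upwards [IsUnifLocDoublingMeasure.ae_tendsto_average_norm_sub volume hb 1] with x hx
  set r : ℕ → ℝ := fun k => (√n + 1) * D.len k with hr
  have hs : 0 < √n + 1 := by positivity
  have hrpos : ∀ k, 0 < r k := fun k => mul_pos hs (D.len_pos k)
  have hr0 : Filter.Tendsto r Filter.atTop (nhdsWithin 0 (Set.Ioi 0)) := by
    refine tendsto_nhdsWithin_iff.2 ⟨?_, Filter.Eventually.of_forall hrpos⟩
    have : Filter.Tendsto (fun k : ℕ => (√n + 1) * (D.side * (1 / 2 : ℝ) ^ k)) Filter.atTop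
        (nhds ((√n + 1) * (D.side * 0))) :=
      ((tendsto_pow_atTop_nhds_zero_of_lt_one (by norm_num) (by norm_num)).const_mul _).const_mul _
    simp only [mul_zero] at this
    refine this.congr fun k => ?_
    rw [hr]
    simp only [len, one_div, inv_pow]
    rfl
  have h := hx (fun _ => x) r hr0 (Filter.Eventually.of_forall fun k =>
    Metric.mem_closedBall_self (by linarith [hrpos k]))
  set V := volume.real (Metric.ball (0 : E) 1)
  -- Lebesgue differentiation is available along balls. The cell lies in a ball whose volume is a
  -- fixed multiple of its own, so the averages over cells converge as well.
  have hbound : ∀ k, |D.avg b k x - b x| ≤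
      ((√n + 1) ^ n * V) * ⨍ y in Metric.closedBall x (r k), ‖b y - b x‖ := by
    intro k
    have hV : 0 < volume.real (Metric.closedBall x (r k)) :=
      ENNReal.toReal_pos (Metric.measure_closedBall_pos _ _ (hrpos k)).ne' measure_closedBall_lt_top.ne
    have hQ := volume_real_cell_pos (D := D) k x
    have e1 : volume.real (Metric.closedBall x (r k)) =
        ((√n + 1) ^ n * V) * volume.real (D.cell k x) := by
      simp only [Measure.real, volume_cell]
      rw [Measure.addHaar_closedBall _ _ (hrpos k).le, ENNReal.toReal_mul, ENNReal.toReal_pow,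
        ENNReal.toReal_ofReal (D.len_pos k).le, ENNReal.toReal_ofReal (by have := hrpos k; positivity)]
      simp only [finrank_euclideanSpace, Fintype.card_fin, hr, mul_pow]
      simp only [V, Measure.real]
      ring
    have hint : IntegrableOn (fun y => ‖b y - b x‖) (Metric.closedBall x (r k)) := by
      refine Integrable.norm (Integrable.sub (hb.integrableOn_isCompact (isCompact_closedBall x _)) ?_)
      exact integrableOn_const measure_closedBall_lt_top.ne
    have e2 : volume.real (D.cell k x) * |D.avg b k x - b x| ≤
        ∫ y in Metric.closedBall x (r k), ‖b y - b x‖ := by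
      calc volume.real (D.cell k x) * |D.avg b k x - b x|
          = ‖∫ y in D.cell k x, (b y - b x)‖ := by
            rw [← avg_sub_const hb, Real.norm_eq_abs, abs_mul, abs_of_pos hQ]
        _ ≤ ∫ y in D.cell k x, ‖b y - b x‖ := norm_integral_le_integral_norm _
        _ ≤ _ := setIntegral_mono_set hint (Filter.Eventually.of_forall fun _ => norm_nonneg _)
            (cell_subset_closedBall k x).eventuallyLE
    rw [setAverage_eq, smul_eq_mul]
    have e3 : ((√n + 1) ^ n * V) * ((volume.real (Metric.closedBall x (r k)))⁻¹ *
        ∫ y in Metric.closedBall x (r k), ‖b y - b x‖) =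
        (∫ y in Metric.closedBall x (r k), ‖b y - b x‖) / volume.real (D.cell k x) := by
      rw [e1] at hV ⊢
      have : (√n + 1) ^ n * V ≠ 0 := fun h0 => by rw [h0, zero_mul] at hV; exact lt_irrefl _ hV
      generalize (√n + 1) ^ n * V = W at this
      field_simp
    rw [e3, le_div_iff₀ hQ, mul_comm]
    exact e2
  rw [tendsto_iff_norm_sub_tendsto_zero]
  have h' := h.const_mul ((√n + 1) ^ n * V)
  rw [mul_zero] at h'
  exact squeeze_zero (fun _ => norm_nonneg _) hbound h'

end Grid

/-! ### The John–Nirenberg inequality -/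

/-- The exponent in the John–Nirenberg inequality. -/
def jnExp (n : ℕ) : ℝ := Real.log (4 / 3) / (2 + 2 ^ n)

theorem jnExp_pos (n : ℕ) : 0 < jnExp n := div_pos (Real.log_pos (by norm_num)) (by positivity)

/-- Here 2 is the stopping threshold and `2 ^ n` bounds the jump of the average into a stopping
cell. The value `4 / 3` makes the recursion close with the constant 4. -/
theorem exp_jnExp (n : ℕ) : Real.exp (jnExp n * (2 + 2 ^ n)) = 4 / 3 := by
  rw [jnExp, div_mul_cancel₀ _ (by positivity), Real.exp_log (by norm_num)]

namespace Grid

variable {D : Grid n}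

theorem lintegral_exp_avg_sub_avg_le {b : E → ℝ} (hb : LocallyIntegrable b)
    (hbmo : bmoNorm b ≤ 1) (K : ℕ) : ∀ d k : ℕ, k + d = K → ∀ x : E,
    ∫⁻ y in D.cell k x, ENNReal.ofReal (Real.exp (jnExp n * |D.avg b K y - D.avg b k y|)) ≤
      4 * volume (D.cell k x) := by
  -- Stopping at level `K` makes the number `d` of remaining levels finite, so induction on `d`
  -- needs no prior integrability of the exponential.
  intro d
  induction d using Nat.strong_induction_on with
  | _ d ih =>
  intro k hk x
  have hc := jnExp_pos n
  set B : ℕ → Set E := fun j =>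
    {y | y ∈ D.cell k x ∧ (k ≤ j ∧ j ≤ K) ∧ 2 < |D.avg b j y - D.avg b k y|} with hB
  have hsat : ∀ j, D.Saturated j (B j) := by
    rintro j y z hyz ⟨h1, h2, h3⟩
    refine ⟨(saturated_cell k x).mono h2.1 hyz h1, h2, ?_⟩
    rwa [← avg_congr b hyz, ← avg_congr b (D.idx_mono h2.1 hyz)]
  have hlt : ∀ j, ∀ y ∈ B j, k < j := by
    rintro j y ⟨_, h2, h3⟩
    refine lt_of_le_of_ne h2.1 ?_
    rintro rfl
    norm_num at h3
  have hvol : 2 * volume (⋃ j, B j) ≤ volume (D.cell k x) := by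
    refine (mul_volume_iUnion_le hsat (g := fun y => ‖b y - D.avg b k x‖ₑ) ?_).trans
      ((lintegral_mono_set (Set.iUnion_subset fun j y hy => hy.1)).trans
        (lintegral_sub_avg_le hbmo k x))
    rintro j y ⟨h1, h2, h3⟩
    refine le_trans ?_ (enorm_avg_sub_mul_le hb j y _)
    gcongr
    rw [Real.enorm_eq_ofReal_abs, ← ENNReal.ofReal_ofNat, ← avg_congr b (show D.idx k y = _ from h1)]
    exact ENNReal.ofReal_le_ofReal h3.le
  have key := lintegral_stopping_le (D := D) hsat (P := D.cell k x) (D.measurableSet_cell k x)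
    (fun j y hy => hy.1)
    (φ := fun y => ENNReal.ofReal (Real.exp (jnExp n * |D.avg b K y - D.avg b k y|)))
    (φ' := fun j y => ENNReal.ofReal (Real.exp (jnExp n * |D.avg b K y - D.avg b j y|)))
    (a := fun _ => ENNReal.ofReal (4 / 3)) (ψ := fun _ => 4) (c := ENNReal.ofReal (4 / 3))
    aemeasurable_const ENNReal.ofReal_ne_top ?_ ?_ ?_
  · refine key.trans ?_
    rw [setLIntegral_const, setLIntegral_const]
    -- The stopping cells fill at most half of the cell, and `4/3 + (4/3) * 4 * (1/2) = 4`.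
    calc ENNReal.ofReal (4 / 3) * volume (D.cell k x) +
          ENNReal.ofReal (4 / 3) * (4 * volume (⋃ j, B j))
        = ENNReal.ofReal (4 / 3) * volume (D.cell k x) +
          ENNReal.ofReal (4 / 3) * 2 * (2 * volume (⋃ j, B j)) := by
          rw [show (4 : ℝ≥0∞) = 2 * 2 by norm_num]; ring
      _ ≤ ENNReal.ofReal (4 / 3) * volume (D.cell k x) +
          ENNReal.ofReal (4 / 3) * 2 * volume (D.cell k x) := by gcongr
      _ = (ENNReal.ofReal (4 / 3) + ENNReal.ofReal (4 / 3) * 2) * volume (D.cell k x) := by ring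
      _ = _ := by
          congr 1
          rw [← ENNReal.ofReal_ofNat, ← ENNReal.ofReal_mul (by norm_num),
            ← ENNReal.ofReal_add (by norm_num) (by norm_num), ← ENNReal.ofReal_ofNat]
          norm_num
  · intro y hy hn
    refine ENNReal.ofReal_le_ofReal ?_
    rw [← exp_jnExp n]
    refine Real.exp_le_exp.2 (mul_le_mul_of_nonneg_left ?_ hc.le)
    have h := hn K
    have h2 : |D.avg b K y - D.avg b k y| ≤ 2 := by
      by_contra hcon
      exact h ⟨hy, ⟨by omega, le_rfl⟩, not_le.1 hcon⟩
    have : (0 : ℝ) ≤ 2 ^ n := by positivity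
    linarith
  -- The level just above `j` has not stopped, so its average is within 2 of the initial one; the
  -- last jump adds at most `2 ^ n`.
  · intro j y hy hn
    have hkj := hlt j y hy
    obtain ⟨i, rfl⟩ := Nat.exists_eq_add_of_lt hkj
    have h2 : |D.avg b (k + i) y - D.avg b k y| ≤ 2 := by
      by_contra hcon
      exact hn (k + i) (by omega) ⟨hy.1, ⟨by omega, by have := hy.2.1.2; omega⟩, not_le.1 hcon⟩
    have h3 := abs_avg_succ_sub_le (D := D) hb hbmo (k + i) y
    refine le_trans ?_ le_add_self
    rw [← ENNReal.ofReal_mul (by norm_num), ← exp_jnExp n, ← Real.exp_add, ← mul_add]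
    refine ENNReal.ofReal_le_ofReal (Real.exp_le_exp.2 (mul_le_mul_of_nonneg_left ?_ hc.le))
    have h4 := abs_sub_le (D.avg b K y) (D.avg b (k + i + 1) y) (D.avg b k y)
    have h5 := abs_sub_le (D.avg b (k + i + 1) y) (D.avg b (k + i) y) (D.avg b k y)
    linarith
  · intro j y hy _
    rw [setLIntegral_const]
    have := hlt j y hy
    have := hy.2.1.2
    exact ih (K - j) (by omega) j (by omega) y

/-- The John–Nirenberg inequality on the cells of a grid. -/
theorem lintegral_exp_sub_avg_le {b : E → ℝ} (hb : LocallyIntegrable b)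
    (hbmo : bmoNorm b ≤ 1) (k : ℕ) (x : E) :
    ∫⁻ y in D.cell k x, ENNReal.ofReal (Real.exp (jnExp n * |b y - D.avg b k y|)) ≤
      4 * volume (D.cell k x) := by
  -- The averages converge to `b` almost everywhere and the bound is uniform in `K`, so Fatou's
  -- lemma applies.
  calc _ = ∫⁻ y in D.cell k x, Filter.liminf (fun K =>
          ENNReal.ofReal (Real.exp (jnExp n * |D.avg b K y - D.avg b k y|))) Filter.atTop := by
        refine setLIntegral_congr_fun_ae (D.measurableSet_cell k x) ?_
        filter_upwards [ae_tendsto_avg (D := D) hb] with y hy _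
        refine (Filter.Tendsto.liminf_eq ?_).symm
        refine (ENNReal.continuous_ofReal.tendsto _).comp ((Real.continuous_exp.tendsto _).comp ?_)
        exact ((hy.sub_const _).abs).const_mul _
    _ ≤ Filter.liminf (fun K => ∫⁻ y in D.cell k x,
          ENNReal.ofReal (Real.exp (jnExp n * |D.avg b K y - D.avg b k y|))) Filter.atTop := by
        refine lintegral_liminf_le fun K => ?_
        have h1 := measurable_avg (D := D) b K
        have h2 := measurable_avg (D := D) b k
        have h3 : Measurable fun y => |D.avg b K y - D.avg b k y| :=
          continuous_abs.measurable.comp (h1.sub h2)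
        exact (Real.measurable_exp.comp (h3.const_mul _)).ennreal_ofReal
    _ ≤ 4 * volume (D.cell k x) := by
        refine Filter.liminf_le_of_le (by isBoundedDefault) fun c hc => ?_
        obtain ⟨K, hK⟩ := Filter.eventually_atTop.1 hc
        exact (hK (max k K) (le_max_right _ _)).trans
          (lintegral_exp_avg_sub_avg_le hb hbmo _ _ k (Nat.add_sub_cancel' (le_max_left _ _)) x)

end Grid

/-! ### Log bumps and a three-factor Hölder inequality -/

/-- The logarithm `log (e + t)`. -/
def elog (t : ℝ) : ℝ := Real.log (Real.exp 1 + t)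

theorem one_le_elog {t : ℝ} (ht : 0 ≤ t) : 1 ≤ elog t := by
  rw [elog, Real.le_log_iff_exp_le (by positivity)]
  linarith

theorem elog_pos {t : ℝ} (ht : 0 ≤ t) : 0 < elog t := one_pos.trans_le (one_le_elog ht)

theorem exp_elog {t : ℝ} (ht : 0 ≤ t) : Real.exp (elog t) = Real.exp 1 + t :=
  Real.exp_log (by positivity)

theorem le_exp_elog {t : ℝ} (ht : 0 ≤ t) : t ≤ Real.exp (elog t) := by
  rw [exp_elog ht]
  have := Real.exp_pos 1
  linarith

/-- A Young function for which the Orlicz maximal function is bounded on `L^r`, cut off at `1`.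
It is complementary to the log bump with exponent `r'`, with one logarithm to spare. -/
def dualBump (r δ t : ℝ) : ℝ := if t < 1 then 0 else t ^ r / elog t ^ (1 + (r - 1) * δ)

theorem dualBump_nonneg (r δ : ℝ) (t : ℝ) : 0 ≤ dualBump r δ t := by
  rw [dualBump]
  split_ifs with h
  · exact le_rfl
  · have ht : 0 ≤ t := by linarith
    have := elog_pos ht
    positivity

theorem dualBump_le_rpow {r δ : ℝ} (hr : 1 < r) (hδ : 0 < δ) {t : ℝ} (ht : 0 ≤ t) :
    dualBump r δ t ≤ t ^ r := by
  rw [dualBump]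
  split_ifs with h
  · positivity
  · refine div_le_self (by positivity) (Real.one_le_rpow (one_le_elog ht) ?_)
    have : 0 < (r - 1) * δ := mul_pos (by linarith) hδ
    linarith

theorem rpow_div_le_dualBump_add_one {r δ : ℝ} (hr : 1 < r) (hδ : 0 < δ) {t : ℝ} (ht : 0 ≤ t) :
    t ^ r / elog t ^ (1 + (r - 1) * δ) ≤ dualBump r δ t + 1 := by
  rw [dualBump]
  split_ifs with h
  · rw [zero_add]
    have h1 : t ^ r ≤ 1 := Real.rpow_le_one ht h.le (by linarith)
    have h2 : 1 ≤ elog t ^ (1 + (r - 1) * δ) := by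
      refine Real.one_le_rpow (one_le_elog ht) ?_
      have : 0 < (r - 1) * δ := mul_pos (by linarith) hδ
      linarith
    rw [div_le_one (by linarith)]
    linarith
  · linarith

theorem measurable_elog : Measurable elog := by
  unfold elog
  fun_prop

theorem measurable_dualBump (r δ : ℝ) : Measurable (dualBump r δ) := by
  unfold dualBump
  refine Measurable.ite measurableSet_Iio measurable_const ?_
  exact (measurable_id.pow_const r).div (measurable_elog.pow_const _)

theorem measurable_logBump (r δ : ℝ) : Measurable (logBump r δ) := by
  unfold logBump
  exact (measurable_id.pow_const r).mul (measurable_elog.pow_const _)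

theorem logBump_nonneg {r δ t : ℝ} (ht : 0 ≤ t) : 0 ≤ logBump r δ t := by
  have := elog_pos ht
  unfold logBump
  rw [elog] at this
  positivity

theorem exists_log_rpow_le {η γ : ℝ} (hη : 0 < η) (hγ : 0 < γ) :
    ∃ C : ℝ, 0 < C ∧ ∀ t : ℝ, 1 ≤ t → Real.log t ^ γ ≤ C * t ^ η := by
  have hηγ : 0 < η / γ := by positivity
  refine ⟨(1 / (η / γ)) ^ γ, by positivity, fun t ht => ?_⟩
  have h1 := Real.log_le_rpow_div (x := t) (by linarith) hηγ
  calc Real.log t ^ γ ≤ (t ^ (η / γ) / (η / γ)) ^ γ :=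
        Real.rpow_le_rpow (Real.log_nonneg ht) h1 hγ.le
    _ = (1 / (η / γ)) ^ γ * t ^ η := by
        rw [div_eq_mul_one_div, Real.mul_rpow (by positivity) (by positivity), ← Real.rpow_mul
          (by linarith), div_mul_cancel₀ _ hγ.ne', mul_comm]

/-- If `elog h` is at most a multiple of `elog w`, Young's inequality applies after moving a power
of the logarithm from `h` to `w`. Otherwise `w` is below a small power of `e + h`, and the gap
between the exponents 1 and `r` absorbs everything. -/
theorem exists_mul_mul_elog_le {r δ : ℝ} (hr : 1 < r) (hδ : 0 < δ) :
    ∃ C : ℝ, 0 < C ∧ ∀ h w : ℝ, 0 ≤ h → 0 ≤ w →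
      h * w * (elog h + elog w) ≤ C * (1 + h ^ r / elog h ^ (1 + (r - 1) * δ) +
        logBump (Real.conjExponent r) δ w) := by
  set r' := Real.conjExponent r with hr'
  set γ := 1 + (r - 1) * δ with hγ
  have hrr : r.HolderConjugate r' := Real.HolderConjugate.conjExponent hr
  have hγ0 : 0 < γ := by have : 0 < (r - 1) * δ := mul_pos (by linarith) hδ
                         linarith
  -- One `η` pays for `w` and one for the logarithms: `1 + 2 * η = r`.
  set η := (r - 1) / 2 with hη
  have hη0 : 0 < η := by rw [hη]; linarith
  -- In the second case `N * elog w ≤ elog h` then gives both `w ≤ (e + h) ^ η` and `elog w ≤ elog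
  -- h`.
  set N := max 1 (1 / η) with hN
  have hN1 : 1 ≤ N := le_max_left _ _
  have hN2 : 1 / N ≤ η := by
    rw [one_div_le (by linarith) hη0]
    exact le_max_right _ _
  obtain ⟨C1, hC1, hlog⟩ := exists_log_rpow_le hη0 (γ := 1 + γ) (by linarith)
  refine ⟨(N + 1) * (N ^ γ + 1) + 2 * C1 * 4 ^ r, by positivity, fun h w hh hw => ?_⟩
  have hlh := one_le_elog hh
  have hlw := one_le_elog hw
  have hB := logBump_nonneg (r := r') (δ := δ) hw
  have hX : 0 ≤ h ^ r / elog h ^ γ := by positivity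
  rcases le_total (elog h) (N * elog w) with hcase | hcase
  -- With this `a` the `r`-th power of the first factor carries the logarithm to the power `-γ`, and
  -- the `r'`-th power of the second carries `(a + 1) * r' = 2 * r' - 1 + δ`, exactly that of the
  -- log bump.
  · set a := γ / r with ha
    have hr0 : 0 < r := by linarith
    have hY := Real.young_inequality_of_nonneg (a := h * elog w ^ (-a)) (b := w * elog w ^ (a + 1))
      (by positivity) (by positivity) hrr
    have e1 : (h * elog w ^ (-a)) * (w * elog w ^ (a + 1)) = h * w * elog w := by
      have : elog w ^ (-a) * elog w ^ (a + 1) = elog w := by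
        rw [← Real.rpow_add (by linarith)]; simp
      calc _ = h * w * (elog w ^ (-a) * elog w ^ (a + 1)) := by ring
        _ = _ := by rw [this]
    have e2 : (h * elog w ^ (-a)) ^ r ≤ N ^ γ * (h ^ r / elog h ^ γ) := by
      rw [Real.mul_rpow hh (by positivity), ← Real.rpow_mul (by linarith), ha,
        neg_mul, div_mul_cancel₀ _ hr0.ne', Real.rpow_neg (by linarith), ← div_eq_mul_inv,
        mul_div_assoc', div_le_div_iff₀ (by positivity) (by positivity)]
      calc h ^ r * elog h ^ γ ≤ h ^ r * (N * elog w) ^ γ := by gcongr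
        _ = _ := by rw [Real.mul_rpow (by linarith) (by linarith)]; ring
    have e3 : (w * elog w ^ (a + 1)) ^ r' = logBump r' δ w := by
      rw [Real.mul_rpow hw (by positivity), ← Real.rpow_mul (by linarith), logBump]
      congr 2
      rw [ha, hγ, hr', Real.conjExponent]
      have : r - 1 ≠ 0 := by linarith
      field_simp
      ring
    rw [e1, e3] at hY
    have hr1 : (h * elog w ^ (-a)) ^ r / r ≤ N ^ γ * (h ^ r / elog h ^ γ) :=
      (div_le_self (by positivity) hr.le).trans e2
    have hr2 : logBump r' δ w / r' ≤ logBump r' δ w := div_le_self hB hrr.symm.lt.le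
    have hNγ : 0 < N ^ γ := by positivity
    calc h * w * (elog h + elog w) ≤ h * w * (N * elog w + elog w) := by gcongr
      _ = (N + 1) * (h * w * elog w) := by ring
      _ ≤ (N + 1) * (N ^ γ * (h ^ r / elog h ^ γ) + logBump r' δ w) := by
          gcongr; linarith
      _ ≤ (N + 1) * ((N ^ γ + 1) * (1 + h ^ r / elog h ^ γ + logBump r' δ w)) := by
          gcongr; nlinarith
      _ ≤ ((N + 1) * (N ^ γ + 1) + 2 * C1 * 4 ^ r) * (1 + h ^ r / elog h ^ γ + logBump r' δ w) := by
          rw [← mul_assoc]; gcongr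
          have : 0 ≤ 2 * C1 * 4 ^ r := by positivity
          linarith
  · set t := Real.exp 1 + h with ht
    have ht1 : 1 ≤ t := by have := Real.add_one_le_exp 1; linarith
    have hlt : Real.log t = elog h := rfl
    have hw1 : w ≤ t ^ (1 / N) := by
      refine (le_exp_elog hw).trans ?_
      rw [Real.rpow_def_of_pos (by linarith), hlt, Real.exp_le_exp, mul_one_div,
        le_div_iff₀ (by linarith), mul_comm]
      exact hcase
    have hw2 : w ≤ t ^ η := hw1.trans (Real.rpow_le_rpow_of_exponent_le ht1 hN2)
    have hlw2 : elog w ≤ elog h := by nlinarith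
    have hht : h ≤ t := by have := Real.exp_pos 1; linarith
    have e1 : h * w * (elog h + elog w) ≤ 2 * (t * t ^ η * elog h) := by
      calc h * w * (elog h + elog w) ≤ t * t ^ η * (elog h + elog h) := by gcongr
        _ = _ := by ring
    have e2 : t * t ^ η * elog h ≤ C1 * (t ^ r / elog h ^ γ) := by
      rw [mul_div_assoc', le_div_iff₀ (by positivity)]
      have h3 := hlog t ht1
      rw [hlt, Real.rpow_add (by linarith), Real.rpow_one] at h3
      calc t * t ^ η * elog h * elog h ^ γ = t * t ^ η * (elog h * elog h ^ γ) := by ring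
        _ ≤ t * t ^ η * (C1 * t ^ η) := by gcongr
        _ = C1 * (t ^ (1 : ℝ) * t ^ η * t ^ η) := by rw [Real.rpow_one]; ring
        _ = C1 * t ^ r := by
            rw [← Real.rpow_add (by linarith), ← Real.rpow_add (by linarith), hη]
            congr 2; ring
    have e3 : t ^ r / elog h ^ γ ≤ 4 ^ r * (1 + h ^ r / elog h ^ γ) := by
      have he : Real.exp 1 < 3 := Real.exp_one_lt_three
      have hγ1 : 1 ≤ elog h ^ γ := Real.one_le_rpow hlh hγ0.le
      rcases le_total h 1 with h1 | h1
      · have : t ^ r ≤ 4 ^ r := Real.rpow_le_rpow (by linarith) (by linarith) (by linarith)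
        calc t ^ r / elog h ^ γ ≤ t ^ r := div_le_self (by positivity) hγ1
          _ ≤ 4 ^ r * 1 := by linarith
          _ ≤ _ := by gcongr; linarith
      · have : t ^ r ≤ 4 ^ r * h ^ r := by
          rw [← Real.mul_rpow (by norm_num) hh]
          exact Real.rpow_le_rpow (by linarith) (by linarith) (by linarith)
        calc t ^ r / elog h ^ γ ≤ 4 ^ r * h ^ r / elog h ^ γ := by gcongr
          _ = 4 ^ r * (h ^ r / elog h ^ γ) := by ring
          _ ≤ _ := by gcongr; linarith
    calc h * w * (elog h + elog w) ≤ 2 * (C1 * (4 ^ r * (1 + h ^ r / elog h ^ γ))) := by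
          refine e1.trans (mul_le_mul_of_nonneg_left (e2.trans ?_) zero_le_two)
          gcongr
      _ = 2 * C1 * 4 ^ r * (1 + h ^ r / elog h ^ γ + 0) := by ring
      _ ≤ ((N + 1) * (N ^ γ + 1) + 2 * C1 * 4 ^ r) *
          (1 + h ^ r / elog h ^ γ + logBump r' δ w) := by
          have : 0 ≤ (N + 1) * (N ^ γ + 1) := by positivity
          gcongr
          linarith

/-- Either `s` is at most a multiple of `elog h + elog w`, and the two-factor inequality with an
extra logarithm applies, or `h * w ≤ exp (c * s / 2)` and the exponential dominates the product. -/
theorem exists_young_exp_dualBump_logBump {r δ c : ℝ} (hr : 1 < r) (hδ : 0 < δ) (hc : 0 < c) :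
    ∃ C : ℝ, 0 < C ∧ ∀ s h w : ℝ, 0 ≤ s → 0 ≤ h → 0 ≤ w →
      s * h * w ≤ C * (Real.exp (c * s) + dualBump r δ h +
        logBump (Real.conjExponent r) δ w) := by
  obtain ⟨C, hC, H⟩ := exists_mul_mul_elog_le hr hδ
  refine ⟨2 / c + 2 / c * C * 2, by positivity, fun s h w hs hh hw => ?_⟩
  have hB := logBump_nonneg (r := Real.conjExponent r) (δ := δ) hw
  have hX := dualBump_nonneg r δ h
  have hexp : 1 ≤ Real.exp (c * s) := Real.one_le_exp (by positivity)
  have hX0 := rpow_div_le_dualBump_add_one (r := r) hr hδ hh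
  rcases le_total s (2 / c * (elog h + elog w)) with hcase | hcase
  · calc s * h * w ≤ 2 / c * (elog h + elog w) * h * w := by gcongr
      _ = 2 / c * (h * w * (elog h + elog w)) := by ring
      _ ≤ 2 / c * (C * (1 + h ^ r / elog h ^ (1 + (r - 1) * δ) +
          logBump (Real.conjExponent r) δ w)) := by
          exact mul_le_mul_of_nonneg_left (H h w hh hw) (by positivity)
      _ ≤ 2 / c * (C * (2 * (Real.exp (c * s) + dualBump r δ h +
          logBump (Real.conjExponent r) δ w))) := by
          gcongr; linarith
      _ = 2 / c * C * 2 * (Real.exp (c * s) + dualBump r δ h +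
          logBump (Real.conjExponent r) δ w) := by ring
      _ ≤ _ := by
          gcongr
          have : 0 < 2 / c := by positivity
          linarith
  · have h1 : h * w ≤ Real.exp (c * s / 2) := by
      calc h * w ≤ Real.exp (elog h) * Real.exp (elog w) :=
            mul_le_mul (le_exp_elog hh) (le_exp_elog hw) hw (Real.exp_pos _).le
        _ = Real.exp (elog h + elog w) := (Real.exp_add _ _).symm
        _ ≤ _ := by
          rw [Real.exp_le_exp]
          rw [div_mul_eq_mul_div, div_le_iff₀ hc] at hcase
          linarith
    have h2 : s ≤ 2 / c * Real.exp (c * s / 2) := by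
      have := Real.add_one_le_exp (c * s / 2)
      rw [div_mul_eq_mul_div, le_div_iff₀ hc]
      linarith
    calc s * h * w = s * (h * w) := by ring
      _ ≤ 2 / c * Real.exp (c * s / 2) * Real.exp (c * s / 2) := by gcongr
      _ = 2 / c * Real.exp (c * s) := by
          rw [mul_assoc, ← Real.exp_add]; ring_nf
      _ ≤ (2 / c + 2 / c * C * 2) * (Real.exp (c * s) + dualBump r δ h +
        logBump (Real.conjExponent r) δ w) := by
          have : 0 < 2 / c * C * 2 := by positivity
          gcongr <;> linarith

theorem exists_lintegral_le_luxNorm_mul_luxNorm {r δ c : ℝ} (hr : 1 < r) (hδ : 0 < δ)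
    (hc : 0 < c) (M : ℝ≥0) :
    ∃ C : ℝ≥0, ∀ (Q : Set E) (s h w : E → ℝ), volume Q ≠ 0 → volume Q ≠ ∞ →
      AEMeasurable s → AEMeasurable w →
      (∀ x, 0 ≤ s x) → (∀ x, 0 ≤ h x) → (∀ x, 0 ≤ w x) →
      ∫⁻ x in Q, ENNReal.ofReal (Real.exp (c * s x)) ≤ M * volume Q →
      luxNorm (dualBump r δ) Q h ≠ ∞ → luxNorm (logBump (Real.conjExponent r) δ) Q w ≠ ∞ →
      ∫⁻ x in Q, ENNReal.ofReal (s x * h x * w x) ≤ C * (luxNorm (dualBump r δ) Q h *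
        luxNorm (logBump (Real.conjExponent r) δ) Q w) * volume Q := by
  obtain ⟨C, hC, H⟩ := exists_young_exp_dualBump_logBump hr hδ hc
  -- `M` comes from the exponential, and 1 from each of the two normalized Luxemburg averages.
  refine ⟨C.toNNReal * (M + 2), fun Q s h w hQ0 hQ hsm hwm hs hh hw hexp h1 h2 => ?_⟩
  set K : ℝ≥0∞ := ((C.toNNReal * (M + 2) : ℝ≥0) : ℝ≥0∞) with hK
  have hK0 : K ≠ 0 := by
    rw [hK, ENNReal.coe_ne_zero]
    have : 0 < C.toNNReal := by simpa using hC
    positivity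
  have hKtop : K ≠ ∞ := ENNReal.coe_ne_top
  have hKQ0 : K * volume Q ≠ 0 := mul_ne_zero hK0 hQ0
  have hKQ : K * volume Q ≠ ∞ := ENNReal.mul_ne_top hKtop hQ
  suffices hs : (∫⁻ x in Q, ENNReal.ofReal (s x * h x * w x)) / (K * volume Q) ≤
      luxNorm (dualBump r δ) Q h * luxNorm (logBump (Real.conjExponent r) δ) Q w by
    rw [ENNReal.div_le_iff hKQ0 hKQ] at hs
    refine hs.trans (le_of_eq ?_)
    ring
  -- The infima need not be attained, so larger admissible values are used; finiteness of both norms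
  -- excludes `0 * ∞` in the limit.
  refine ENNReal.le_mul_of_forall_lt (Or.inr h2) (Or.inl h1) fun a ha b hb => ?_
  simp only [luxNorm, gt_iff_lt, iInf_lt_iff] at ha hb
  obtain ⟨l, hl, hl1, hla⟩ := ha
  obtain ⟨m, hm, hm1, hmb⟩ := hb
  refine le_trans ?_ (mul_le_mul' hla.le hmb.le)
  rw [ENNReal.div_le_iff hKQ0 hKQ]
  rw [setLAverage_eq, ENNReal.div_le_iff hQ0 hQ, one_mul] at hl1 hm1
  have hpt : ∀ x, ENNReal.ofReal (s x * h x * w x) ≤ ENNReal.ofReal (l * m * C) *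
      ((ENNReal.ofReal (Real.exp (c * s x)) +
        ENNReal.ofReal (logBump (Real.conjExponent r) δ (|w x| / m))) +
        ENNReal.ofReal (dualBump r δ (|h x| / l))) := by
    intro x
    have hlx : 0 ≤ |h x| / l := by positivity
    have hmx : 0 ≤ |w x| / m := by positivity
    rw [← ENNReal.ofReal_add (Real.exp_pos _).le (logBump_nonneg hmx), ← ENNReal.ofReal_add
      (add_nonneg (Real.exp_pos _).le (logBump_nonneg hmx)) (dualBump_nonneg _ _ _),
      ← ENNReal.ofReal_mul (by positivity)]
    refine ENNReal.ofReal_le_ofReal ?_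
    have h3 := H (s x) (|h x| / l) (|w x| / m) (hs x) hlx hmx
    calc s x * h x * w x = l * m * (s x * (|h x| / l) * (|w x| / m)) := by
          rw [abs_of_nonneg (hh x), abs_of_nonneg (hw x)]; field_simp
      _ ≤ l * m * (C * _) := mul_le_mul_of_nonneg_left h3 (by positivity)
      _ = _ := by ring
  have hm1' : AEMeasurable (fun x => ENNReal.ofReal (Real.exp (c * s x))) :=
    (Real.measurable_exp.comp_aemeasurable (hsm.const_mul c)).ennreal_ofReal
  have hm2' : AEMeasurable
      (fun x => ENNReal.ofReal (logBump (Real.conjExponent r) δ (|w x| / m))) :=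
    ((measurable_logBump _ _).comp_aemeasurable
      ((continuous_abs.measurable.comp_aemeasurable hwm).div_const m)).ennreal_ofReal
  calc ∫⁻ x in Q, ENNReal.ofReal (s x * h x * w x)
      ≤ ∫⁻ x in Q, ENNReal.ofReal (l * m * C) * ((ENNReal.ofReal (Real.exp (c * s x)) +
        ENNReal.ofReal (logBump (Real.conjExponent r) δ (|w x| / m))) +
        ENNReal.ofReal (dualBump r δ (|h x| / l))) := lintegral_mono hpt
    _ = ENNReal.ofReal (l * m * C) * (((∫⁻ x in Q, ENNReal.ofReal (Real.exp (c * s x))) +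
        ∫⁻ x in Q, ENNReal.ofReal (logBump (Real.conjExponent r) δ (|w x| / m))) +
        ∫⁻ x in Q, ENNReal.ofReal (dualBump r δ (|h x| / l))) := by
        rw [lintegral_const_mul' _ _ ENNReal.ofReal_ne_top,
          lintegral_add_left' (f := fun x => ENNReal.ofReal (Real.exp (c * s x)) +
            ENNReal.ofReal (logBump (Real.conjExponent r) δ (|w x| / m))) (hm1'.add hm2').restrict,
          lintegral_add_left' hm1'.restrict]
    _ ≤ ENNReal.ofReal (l * m * C) * ((M * volume Q + volume Q) + volume Q) := by gcongr
    _ = _ := by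
        rw [ENNReal.ofReal_mul (by positivity), ENNReal.ofReal_mul hl.le, hK]
        push_cast
        rw [show ENNReal.ofReal C = (C.toNNReal : ℝ≥0∞) from rfl]
        ring

theorem luxNorm_dualBump_le {r δ : ℝ} (hr : 1 < r) (hδ : 0 < δ) {Q : Set E} (hQ0 : volume Q ≠ 0)
    (hQ : volume Q ≠ ∞) {h : E → ℝ} :
    luxNorm (dualBump r δ) Q h ≤ ((∫⁻ x in Q, ‖h x‖ₑ ^ r) / volume Q) ^ (1 / r) := by
  have hr0 : 0 < r := by linarith
  refine le_of_forall_gt_imp_ge_of_dense fun c hc => ?_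
  rcases eq_or_ne c ∞ with rfl | hctop
  · exact le_top
  have hc0 : 0 < c.toReal := ENNReal.toReal_pos (pos_of_gt hc).ne' hctop
  have hcr0 : c ^ r ≠ 0 := by
    rw [Ne, ENNReal.rpow_eq_zero_iff]
    rintro (⟨h1, -⟩ | ⟨h1, -⟩)
    · exact (pos_of_gt hc).ne' h1
    · exact hctop h1
  have hcr : c ^ r ≠ ∞ := ENNReal.rpow_ne_top_of_nonneg hr0.le hctop
  have h1 : ∫⁻ x in Q, ‖h x‖ₑ ^ r ≤ c ^ r * volume Q := by
    rw [one_div, ENNReal.rpow_inv_lt_iff hr0, ENNReal.div_lt_iff (Or.inl hQ0) (Or.inl hQ)] at hc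
    exact hc.le
  refine iInf₂_le_of_le c.toReal hc0 (iInf_le_of_le ?_ (ENNReal.ofReal_toReal hctop).le)
  rw [setLAverage_eq, ENNReal.div_le_iff hQ0 hQ, one_mul]
  have hpt : ∀ x, ENNReal.ofReal (dualBump r δ (|h x| / c.toReal)) ≤ ‖h x‖ₑ ^ r * (c ^ r)⁻¹ := by
    intro x
    refine (ENNReal.ofReal_le_ofReal (dualBump_le_rpow hr hδ (by positivity))).trans (le_of_eq ?_)
    rw [← ENNReal.ofReal_rpow_of_nonneg (by positivity) hr0.le, ENNReal.ofReal_div_of_pos hc0,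
      ENNReal.div_rpow_of_nonneg _ _ hr0.le, ENNReal.ofReal_toReal hctop, div_eq_mul_inv,
      Real.enorm_eq_ofReal_abs]
  calc _ ≤ ∫⁻ x in Q, ‖h x‖ₑ ^ r * (c ^ r)⁻¹ := lintegral_mono hpt
    _ = (∫⁻ x in Q, ‖h x‖ₑ ^ r) * (c ^ r)⁻¹ :=
        lintegral_mul_const' _ _ (ENNReal.inv_ne_top.2 hcr0)
    _ ≤ c ^ r * volume Q * (c ^ r)⁻¹ := by gcongr
    _ = c ^ r * (c ^ r)⁻¹ * volume Q := by ring
    _ = _ := by rw [ENNReal.mul_inv_cancel hcr0 hcr, one_mul]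

/-! ### The dyadic Orlicz maximal function -/

theorem add_one_div_four_le_elog (j : ℕ) {t : ℝ} (ht : 2 ^ j ≤ t) : ((j : ℝ) + 1) / 4 ≤ elog t := by
  have h0 : (0 : ℝ) < 2 ^ j := by positivity
  have h1 := one_le_elog (h0.le.trans ht)
  have h2 : j * Real.log 2 ≤ elog t := by
    rw [← Real.log_pow, elog]
    exact Real.log_le_log h0 (by have := Real.exp_pos 1; linarith)
  have h3 := Real.log_two_gt_d9
  have h4 : (j : ℝ) * (1 / 2) ≤ j * Real.log 2 := by gcongr; linarith
  linarith

/-- This is the discrete form of the `B_r` condition, the convergence of `∫ Φ(t) t^(-r) dt/t`. The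
cut-off of `dualBump` at 1 removes the large `k`; for `t / 2 ^ k` of size `2 ^ j` the term is at
most a multiple of `t ^ r / (j + 1) ^ γ`, and `γ > 1` because `δ > 0`. -/
theorem exists_tsum_dualBump_le {r δ : ℝ} (hr : 1 < r) (hδ : 0 < δ) :
    ∃ C : ℝ≥0, ∀ t : ℝ, 0 ≤ t →
      ∑' k : ℤ, ENNReal.ofReal ((2 : ℝ) ^ (k + 1)) ^ r *
        ENNReal.ofReal (dualBump r δ (t / (2 : ℝ) ^ k)) ≤ C * ENNReal.ofReal t ^ r := by
  set γ := 1 + (r - 1) * δ with hγ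
  have hr0 : 0 < r := by linarith
  have hγ1 : 1 < γ := by have : 0 < (r - 1) * δ := mul_pos (by linarith) hδ
                         linarith
  have hsum : Summable fun j : ℕ => 2 ^ r * 4 ^ γ * (1 / ((j : ℝ) + 1) ^ γ) := by
    refine Summable.mul_left _ ?_
    have := (summable_nat_add_iff 1).2 (Real.summable_one_div_nat_rpow.2 hγ1)
    simpa using this
  refine ⟨(∑' j : ℕ, ENNReal.ofReal (2 ^ r * 4 ^ γ * (1 / ((j : ℝ) + 1) ^ γ))).toNNReal,
    fun t ht => ?_⟩
  rw [ENNReal.coe_toNNReal hsum.tsum_ofReal_ne_top]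
  rcases ht.eq_or_lt with rfl | ht0
  · have : dualBump r δ 0 = 0 := by simp [dualBump]
    simp [this]
  obtain ⟨m, hm1, hm2⟩ := exists_mem_Ico_zpow ht0 (one_lt_two (α := ℝ))
  have hinj : Function.Injective fun j : ℕ => m - (j : ℤ) := fun a b h => by
    simpa using h
  rw [← hinj.tsum_eq, ← ENNReal.tsum_mul_right]
  · refine ENNReal.tsum_le_tsum fun j => ?_
    have hp : (0 : ℝ) < 2 ^ (m - (j : ℤ)) := by positivity
    have hge : (2 : ℝ) ^ j ≤ t / 2 ^ (m - (j : ℤ)) := by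
      rw [le_div_iff₀ hp, ← zpow_natCast, ← zpow_add₀ two_ne_zero]
      simpa using hm1
    have he := add_one_div_four_le_elog j hge
    rw [ENNReal.ofReal_rpow_of_nonneg (by positivity) hr0.le,
      ENNReal.ofReal_rpow_of_nonneg ht hr0.le, ← ENNReal.ofReal_mul (by positivity),
      ← ENNReal.ofReal_mul (by positivity)]
    refine ENNReal.ofReal_le_ofReal ?_
    have h1 : ¬ t / 2 ^ (m - (j : ℤ)) < 1 :=
      not_lt.2 ((one_le_pow₀ one_le_two).trans hge)
    rw [dualBump, ← hγ, if_neg h1, Real.div_rpow ht hp.le, zpow_add₀ two_ne_zero, zpow_one,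
      Real.mul_rpow hp.le zero_le_two]
    have hj : (0 : ℝ) < ((j : ℝ) + 1) / 4 := by positivity
    have h2 : 1 / elog (t / 2 ^ (m - (j : ℤ))) ^ γ ≤ 4 ^ γ * (1 / ((j : ℝ) + 1) ^ γ) := by
      calc 1 / elog (t / 2 ^ (m - (j : ℤ))) ^ γ ≤ 1 / (((j : ℝ) + 1) / 4) ^ γ := by gcongr
        _ = _ := by
          rw [Real.div_rpow (by positivity) (by norm_num)]
          field_simp
    have hpr : 0 < ((2 : ℝ) ^ (m - (j : ℤ))) ^ r := Real.rpow_pos_of_pos hp r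
    calc _ = 2 ^ r * t ^ r * (1 / elog (t / 2 ^ (m - (j : ℤ))) ^ γ) := by
          field_simp
      _ ≤ 2 ^ r * t ^ r * (4 ^ γ * (1 / ((j : ℝ) + 1) ^ γ)) := by gcongr
      _ = _ := by ring
  · intro k hk
    by_contra hcon
    apply hk
    have hkm : m < k := by
      by_contra hle
      refine hcon ⟨(m - k).toNat, ?_⟩
      simp only
      omega
    have : t / 2 ^ k < 1 := by
      rw [div_lt_one (by positivity)]
      exact hm2.trans_le (zpow_le_zpow_right₀ one_le_two (by omega))
    simp [dualBump, this]

namespace Grid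

variable {D : Grid n}

variable (D) in
/-- The dyadic Orlicz maximal function. -/
def luxMax (Φ : ℝ → ℝ) (h : E → ℝ) (x : E) : ℝ≥0∞ := ⨆ k, luxNorm Φ (D.cell k x) h

theorem luxNorm_cell_le_luxMax (Φ : ℝ → ℝ) (h : E → ℝ) (k : ℕ) {x y : E} (hy : y ∈ D.cell k x) :
    luxNorm Φ (D.cell k x) h ≤ D.luxMax Φ h y := by
  rw [← D.cell_eq hy]
  exact le_iSup (fun k => luxNorm Φ (D.cell k y) h) k

theorem saturated_luxNorm (Φ : ℝ → ℝ) (h : E → ℝ) (c : ℝ≥0∞) (k : ℕ) :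
    D.Saturated k {x | c < luxNorm Φ (D.cell k x) h} := fun x y hxy hx => by
  rw [Set.mem_ofPred_eq] at hx ⊢
  rwa [D.cell_eq (x := x) (y := y) hxy.symm]

theorem setOf_lt_luxMax (Φ : ℝ → ℝ) (h : E → ℝ) (c : ℝ≥0∞) :
    {x | c < D.luxMax Φ h x} = ⋃ k, {x | c < luxNorm Φ (D.cell k x) h} := by
  ext x
  simp [luxMax, lt_iSup_iff]

theorem measurable_luxMax (Φ : ℝ → ℝ) (h : E → ℝ) : Measurable (D.luxMax Φ h) :=
  measurable_of_Ioi fun c => by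
    change MeasurableSet {x | c < D.luxMax Φ h x}
    rw [setOf_lt_luxMax]
    exact MeasurableSet.iUnion fun k => (saturated_luxNorm Φ h c k).measurableSet

/-- If the norm on a cell exceeds `l`, then `l` is not admissible there, so the average of `Φ(|h| /
l)` is above 1. Chebyshev over the maximal cells finishes. -/
theorem volume_lt_luxMax_le (Φ : ℝ → ℝ) (h : E → ℝ) {l : ℝ} (hl : 0 < l) :
    volume {x | ENNReal.ofReal l < D.luxMax Φ h x} ≤
      ∫⁻ x, ENNReal.ofReal (Φ (|h x| / l)) := by
  rw [setOf_lt_luxMax]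
  have := mul_volume_iUnion_le (saturated_luxNorm (D := D) Φ h (ENNReal.ofReal l))
    (g := fun x => ENNReal.ofReal (Φ (|h x| / l))) (t := 1) fun k x hx => by
      rw [one_mul]
      by_contra hcon
      refine absurd (show ENNReal.ofReal l < _ from hx) (not_lt.2 ?_)
      refine iInf₂_le_of_le l hl (iInf_le_of_le ?_ le_rfl)
      rw [setLAverage_eq, ENNReal.div_le_iff (D.volume_cell_ne_zero k x)
        (D.volume_cell_ne_top k x), one_mul]
      exact (not_le.1 hcon).le
  rw [one_mul] at this
  exact this.trans (setLIntegral_le_lintegral _ _)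

/-- The weak-type bound at the heights `2 ^ k` is summed by the discrete `B_r` condition. -/
theorem exists_lintegral_luxMax_rpow_le {r δ : ℝ} (hr : 1 < r) (hδ : 0 < δ) :
    ∃ C : ℝ≥0, ∀ (D : Grid n) (h : E → ℝ), AEMeasurable h →
      ∫⁻ x, D.luxMax (dualBump r δ) h x ^ r ≤ C * ∫⁻ x, ‖h x‖ₑ ^ r := by
  obtain ⟨C, hC⟩ := exists_tsum_dualBump_le hr hδ
  have hr0 : 0 < r := by linarith
  refine ⟨C, fun D h hh => ?_⟩
  set N := D.luxMax (dualBump r δ) h with hN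
  have hNm : Measurable N := measurable_luxMax _ _
  have hset : ∀ k : ℤ, MeasurableSet {x | ENNReal.ofReal ((2 : ℝ) ^ k) < N x} :=
    fun k => measurableSet_lt measurable_const hNm
  have hpt : ∀ x, N x ^ r ≤ ∑' k : ℤ, {x | ENNReal.ofReal ((2 : ℝ) ^ k) < N x}.indicator
      (fun _ => ENNReal.ofReal ((2 : ℝ) ^ (k + 1)) ^ r) x := by
    intro x
    rw [← ENNReal.le_rpow_inv_iff hr0]
    -- Testing with finite `c` below the value also covers points where the maximal function is
    -- infinite.
    refine le_of_forall_lt_imp_le_of_dense fun c hc => ?_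
    rcases eq_or_ne c 0 with rfl | hc0
    · exact zero_le
    have hct : c ≠ ∞ := hc.ne_top
    have hcp : 0 < c.toReal := ENNReal.toReal_pos hc0 hct
    obtain ⟨k, hk1, hk2⟩ := exists_mem_Ioc_zpow hcp (one_lt_two (α := ℝ))
    rw [ENNReal.le_rpow_inv_iff hr0]
    refine le_trans ?_ (ENNReal.le_tsum k)
    rw [Set.indicator_of_mem]
    · refine ENNReal.rpow_le_rpow ?_ hr0.le
      rw [← ENNReal.ofReal_toReal hct]
      exact ENNReal.ofReal_le_ofReal hk2
    · refine lt_of_le_of_lt ?_ hc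
      rw [← ENNReal.ofReal_toReal hct]
      exact ENNReal.ofReal_le_ofReal hk1.le
  have hm : ∀ k : ℤ, AEMeasurable fun x =>
      ENNReal.ofReal (dualBump r δ (|h x| / (2 : ℝ) ^ k)) := fun k =>
    ((measurable_dualBump r δ).comp_aemeasurable
      ((continuous_abs.measurable.comp_aemeasurable hh).div_const _)).ennreal_ofReal
  calc ∫⁻ x, N x ^ r
      ≤ ∫⁻ x, ∑' k : ℤ, {x | ENNReal.ofReal ((2 : ℝ) ^ k) < N x}.indicator
        (fun _ => ENNReal.ofReal ((2 : ℝ) ^ (k + 1)) ^ r) x := lintegral_mono hpt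
    _ = ∑' k : ℤ, ENNReal.ofReal ((2 : ℝ) ^ (k + 1)) ^ r *
        volume {x | ENNReal.ofReal ((2 : ℝ) ^ k) < N x} := by
        rw [lintegral_tsum fun k => (measurable_const.indicator (hset k)).aemeasurable]
        refine tsum_congr fun k => ?_
        rw [lintegral_indicator_const (hset k)]
    _ ≤ ∑' k : ℤ, ENNReal.ofReal ((2 : ℝ) ^ (k + 1)) ^ r *
        ∫⁻ x, ENNReal.ofReal (dualBump r δ (|h x| / (2 : ℝ) ^ k)) := by
        refine ENNReal.tsum_le_tsum fun k => mul_le_mul_right ?_ _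
        exact volume_lt_luxMax_le _ h (by positivity)
    _ = ∫⁻ x, ∑' k : ℤ, ENNReal.ofReal ((2 : ℝ) ^ (k + 1)) ^ r *
        ENNReal.ofReal (dualBump r δ (|h x| / (2 : ℝ) ^ k)) := by
        rw [lintegral_tsum fun k => (hm k).const_mul _]
        refine tsum_congr fun k => ?_
        rw [lintegral_const_mul' _ _ (ENNReal.rpow_ne_top_of_nonneg hr0.le ENNReal.ofReal_ne_top)]
    _ ≤ ∫⁻ x, C * ‖h x‖ₑ ^ r := lintegral_mono fun x => by
        rw [Real.enorm_eq_ofReal_abs]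
        exact hC _ (abs_nonneg _)
    _ = _ := lintegral_const_mul' _ _ ENNReal.coe_ne_top

end Grid

/-! ### The bilinear form on a single cell -/

/-- The standing hypotheses of the dyadic bilinear estimate: `b` has `BMO` norm at most `1`, the
factors `w` and `v` satisfy the bump condition with constant `T`, and `h ∈ L^r`, `g ∈ L^s`. -/
structure Admissible (α r s δ : ℝ) (b w v h g : E → ℝ) (T : ℝ≥0∞) : Prop where
  locallyIntegrable : LocallyIntegrable b
  bmoNorm_le : bmoNorm b ≤ 1
  aemeasurable_w : AEMeasurable w
  aemeasurable_v : AEMeasurable v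
  aemeasurable_h : AEMeasurable h
  aemeasurable_g : AEMeasurable g
  w_nonneg : ∀ x, 0 ≤ w x
  v_nonneg : ∀ x, 0 ≤ v x
  h_nonneg : ∀ x, 0 ≤ h x
  g_nonneg : ∀ x, 0 ≤ g x
  ne_top : T ≠ ∞
  bump_le : ∀ (a : E) (l : ℝ), 0 < l → volume (cube a l) ^ (α / n + 1 - 1 / r - 1 / s) *
    luxNorm (logBump (Real.conjExponent s) δ) (cube a l) v *
    luxNorm (logBump (Real.conjExponent r) δ) (cube a l) w ≤ T
  h_lt_top : ∫⁻ x, ‖h x‖ₑ ^ r ≠ ∞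
  g_lt_top : ∫⁻ x, ‖g x‖ₑ ^ s ≠ ∞

namespace Grid

variable {D : Grid n}

variable (D) in
/-- The average of a non-negative function over the cell of level `k` that contains `x`. -/
def lavg (G : E → ℝ≥0∞) (k : ℕ) (x : E) : ℝ≥0∞ :=
  (∫⁻ y in D.cell k x, G y) / volume (D.cell k x)

theorem lavg_congr (G : E → ℝ≥0∞) {k : ℕ} {x y : E} (h : D.idx k x = D.idx k y) :
    D.lavg G k x = D.lavg G k y := by
  rw [lavg, lavg, D.cell_eq (show x ∈ D.cell k y from h)]

theorem lavg_mul_volume (G : E → ℝ≥0∞) (k : ℕ) (x : E) :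
    D.lavg G k x * volume (D.cell k x) = ∫⁻ y in D.cell k x, G y :=
  ENNReal.div_mul_cancel (D.volume_cell_ne_zero k x) (D.volume_cell_ne_top k x)

theorem volume_cell_rpow (hn : n ≠ 0) (α : ℝ) (k : ℕ) (x : E) :
    volume (D.cell k x) ^ (α / n) = ENNReal.ofReal (D.len k ^ α) := by
  rw [volume_cell, ← ENNReal.rpow_natCast, ← ENNReal.rpow_mul,
    mul_div_cancel₀ _ (Nat.cast_ne_zero.2 hn), ENNReal.ofReal_rpow_of_pos (D.len_pos k)]

theorem luxNorm_dualBump_cell_le {r δ : ℝ} (hr : 1 < r) (hδ : 0 < δ) (h : E → ℝ) (k : ℕ) (x : E) :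
    luxNorm (dualBump r δ) (D.cell k x) h ≤
      volume (D.cell k x) ^ (-(1 / r)) * (∫⁻ x, ‖h x‖ₑ ^ r) ^ (1 / r) := by
  have hr0 : 0 < r := by linarith
  refine (luxNorm_dualBump_le hr hδ (D.volume_cell_ne_zero k x) (D.volume_cell_ne_top k x)).trans ?_
  rw [ENNReal.div_rpow_of_nonneg _ _ (by positivity), ENNReal.rpow_neg, mul_comm, ← div_eq_mul_inv]
  gcongr
  exact Measure.restrict_le_self

theorem luxNorm_dualBump_cell_ne_top {r δ : ℝ} (hr : 1 < r) (hδ : 0 < δ) {h : E → ℝ}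
    (hh : ∫⁻ x, ‖h x‖ₑ ^ r ≠ ∞) (k : ℕ) (x : E) :
    luxNorm (dualBump r δ) (D.cell k x) h ≠ ∞ := by
  have hr0 : 0 < r := by linarith
  refine ne_top_of_le_ne_top (ENNReal.mul_ne_top ?_ ?_) (luxNorm_dualBump_cell_le hr hδ h k x)
  · rw [Ne, ENNReal.rpow_eq_top_iff]
    have := D.volume_cell_ne_zero k x
    have := D.volume_cell_ne_top k x
    tauto
  · exact ENNReal.rpow_ne_top_of_nonneg (by positivity) hh

/-- Hölder produces the norms `X`, `Y` of `h`, `g` and those of the weights. The bump condition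
absorbs the latter and leaves `V ^ θ * X * Y * V` with `θ = 1/r + 1/s - 1`. Since `X ≤ V ^ (-1/r)
‖h‖_r`, a power `X ^ (r * θ)` pays for `V ^ θ`. The remaining power is `p / q` when `r = p` and `s =
q'`, and `hrs` amounts to `p ≤ q`. -/
theorem exists_lavg_mul_lintegral_le (hn : n ≠ 0) {α r s δ : ℝ} (hr : 1 < r) (hs : 1 < s)
    (hδ : 0 < δ) (hrs : r * (1 - 1 / s) ≤ 1) :
    ∃ C : ℝ≥0, ∀ (D : Grid n) (b w v h g : E → ℝ) (T : ℝ≥0∞), Admissible α r s δ b w v h g T →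
      ∀ (k : ℕ) (x : E),
        D.lavg (fun y => ENNReal.ofReal (g y * v y)) k x * (ENNReal.ofReal (D.len k ^ α) *
          ∫⁻ y in D.cell k x, ENNReal.ofReal ((1 + |b y - D.avg b k y|) * h y * w y)) ≤
        C * T * (∫⁻ x, ‖h x‖ₑ ^ r) ^ ((1 - r * (1 - 1 / s)) / r) *
          ((luxNorm (dualBump r δ) (D.cell k x) h ^ (r * (1 - 1 / s)) *
            luxNorm (dualBump s δ) (D.cell k x) g) * volume (D.cell k x)) := by
  have hr0 : 0 < r := by linarith
  set M : ℝ≥0 := (Real.exp (jnExp n)).toNNReal * 4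
  obtain ⟨C1, hC1⟩ := exists_lintegral_le_luxNorm_mul_luxNorm (n := n) hr hδ (jnExp_pos n) M
  obtain ⟨C2, hC2⟩ := exists_lintegral_le_luxNorm_mul_luxNorm (n := n) hs hδ (jnExp_pos n) M
  refine ⟨C1 * C2, fun D b w v h g T hA k x => ?_⟩
  set V := volume (D.cell k x) with hV
  have hV0 : V ≠ 0 := D.volume_cell_ne_zero k x
  have hVt : V ≠ ∞ := D.volume_cell_ne_top k x
  set A := luxNorm (logBump (Real.conjExponent s) δ) (D.cell k x) v with hAdef
  set B := luxNorm (logBump (Real.conjExponent r) δ) (D.cell k x) w with hBdef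
  set X := luxNorm (dualBump r δ) (D.cell k x) h with hX
  set Y := luxNorm (dualBump s δ) (D.cell k x) g with hY
  have hXt : X ≠ ∞ := luxNorm_dualBump_cell_ne_top hr hδ hA.h_lt_top k x
  have hYt : Y ≠ ∞ := luxNorm_dualBump_cell_ne_top hs hδ hA.g_lt_top k x
  have hb := hA.locallyIntegrable
  have hSm : AEMeasurable fun y => 1 + |b y - D.avg b k y| :=
    (continuous_abs.measurable.comp_aemeasurable
      (hb.aestronglyMeasurable.aemeasurable.sub (measurable_avg b k).aemeasurable)).const_add 1
  have hexp : ∫⁻ y in D.cell k x,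
      ENNReal.ofReal (Real.exp (jnExp n * (1 + |b y - D.avg b k y|))) ≤ M * V := by
    have := lintegral_exp_sub_avg_le (D := D) hb hA.bmoNorm_le k x
    calc _ = ∫⁻ y in D.cell k x, ENNReal.ofReal (Real.exp (jnExp n)) *
          ENNReal.ofReal (Real.exp (jnExp n * |b y - D.avg b k y|)) := by
          refine lintegral_congr fun y => ?_
          rw [← ENNReal.ofReal_mul (Real.exp_pos _).le, ← Real.exp_add, mul_add, mul_one]
      _ ≤ ENNReal.ofReal (Real.exp (jnExp n)) * (4 * V) := by
          rw [lintegral_const_mul' _ _ ENNReal.ofReal_ne_top]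
          gcongr
      _ = M * V := by
          simp only [M]
          push_cast
          rw [← mul_assoc]
          rfl
  have hbump : V ^ (α / n + 1 - 1 / r - 1 / s) * A * B ≤ T := by
    have := hA.bump_le (D.corner k x) (D.len k) (D.len_pos k)
    rwa [← cell_eq_cube] at this
  have hVp0 : V ^ (α / n + 1 - 1 / r - 1 / s) ≠ 0 := by
    rw [Ne, ENNReal.rpow_eq_zero_iff]; tauto
  have hF : B ≠ ∞ → ∫⁻ y in D.cell k x,
      ENNReal.ofReal ((1 + |b y - D.avg b k y|) * h y * w y) ≤ C1 * (X * B) * V := fun hB =>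
    hC1 (D.cell k x) (fun y => 1 + |b y - D.avg b k y|) h w hV0 hVt hSm hA.aemeasurable_w
      (fun y => by positivity) hA.h_nonneg hA.w_nonneg hexp hXt hB
  -- Inserting the factor `1 + |b - b_Q| ≥ 1` lets the same three-factor inequality serve here.
  have hG : A ≠ ∞ → D.lavg (fun y => ENNReal.ofReal (g y * v y)) k x ≤ C2 * (Y * A) := fun hA' => by
    rw [lavg, ENNReal.div_le_iff hV0 hVt]
    refine le_trans ?_ (hC2 (D.cell k x) (fun y => 1 + |b y - D.avg b k y|) g v hV0 hVt hSm
      hA.aemeasurable_v (fun y => by positivity) hA.g_nonneg hA.v_nonneg hexp hYt hA')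
    refine lintegral_mono fun y => ENNReal.ofReal_le_ofReal ?_
    have h1 := mul_nonneg (hA.g_nonneg y) (hA.v_nonneg y)
    have h2 := abs_nonneg (b y - D.avg b k y)
    nlinarith [mul_nonneg h2 h1]
  -- If one bump norm is infinite, finiteness of `T` forces the other to vanish, and then the left
  -- side is zero.
  by_cases hAt : A = ∞
  · have hB0 : B = 0 := by
      by_contra hB
      rw [hAt, ENNReal.mul_top hVp0, ENNReal.top_mul hB] at hbump
      exact hA.ne_top (top_le_iff.1 hbump)
    have := hF (by rw [hB0]; exact ENNReal.zero_ne_top)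
    rw [hB0, mul_zero, mul_zero, zero_mul, nonpos_iff_eq_zero] at this
    rw [this, mul_zero, mul_zero]
    exact zero_le
  by_cases hBt : B = ∞
  · have hA0 : A = 0 := by
      by_contra hA'
      rw [hBt, ENNReal.mul_top (mul_ne_zero hVp0 hA')] at hbump
      exact hA.ne_top (top_le_iff.1 hbump)
    have := hG hAt
    rw [hA0, mul_zero, mul_zero, nonpos_iff_eq_zero] at this
    rw [this, zero_mul]
    exact zero_le
  set θ := 1 / r + 1 / s - 1 with hθ
  have hrθ : r * θ = 1 - r * (1 - 1 / s) := by
    rw [hθ]; field_simp; ring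
  have hθ0 : 0 ≤ θ := by
    have : 0 ≤ r * θ := by rw [hrθ]; linarith
    exact nonneg_of_mul_nonneg_right this hr0
  have hρ0 : 0 ≤ r * (1 - 1 / s) := by
    have : 1 / s ≤ 1 := by rw [div_le_one (by linarith)]; exact hs.le
    exact mul_nonneg hr0.le (by linarith)
  set H := ∫⁻ x, ‖h x‖ₑ ^ r with hH
  have hXH : V ^ θ * X ≤ H ^ ((1 - r * (1 - 1 / s)) / r) * X ^ (r * (1 - 1 / s)) := by
    have e1 : X = X ^ (r * θ) * X ^ (r * (1 - 1 / s)) := by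
      rw [← ENNReal.rpow_add_of_nonneg _ _ (by positivity) hρ0, hrθ]
      simp
    have e2 : X ^ (r * θ) ≤ V ^ (-θ) * H ^ ((1 - r * (1 - 1 / s)) / r) := by
      have := ENNReal.rpow_le_rpow (luxNorm_dualBump_cell_le (D := D) hr hδ h k x)
        (show 0 ≤ r * θ by positivity)
      refine this.trans (le_of_eq ?_)
      rw [ENNReal.mul_rpow_of_nonneg _ _ (by positivity), ← ENNReal.rpow_mul, ← ENNReal.rpow_mul,
        ← hrθ]
      congr 2 <;> field_simp
    calc V ^ θ * X = V ^ θ * (X ^ (r * θ) * X ^ (r * (1 - 1 / s))) := by rw [← e1]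
      _ ≤ V ^ θ * (V ^ (-θ) * H ^ ((1 - r * (1 - 1 / s)) / r) * X ^ (r * (1 - 1 / s))) := by gcongr
      _ = V ^ θ * V ^ (-θ) * (H ^ ((1 - r * (1 - 1 / s)) / r) * X ^ (r * (1 - 1 / s))) := by ring
      _ = _ := by
        rw [← ENNReal.rpow_add _ _ hV0 hVt, add_neg_cancel, ENNReal.rpow_zero, one_mul]
  have hVθ : V ^ (α / n) = V ^ θ * V ^ (α / n + 1 - 1 / r - 1 / s) := by
    rw [← ENNReal.rpow_add _ _ hV0 hVt, hθ]
    congr 1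
    ring
  rw [← volume_cell_rpow (x := x) hn, ← hV]
  calc _ ≤ C2 * (Y * A) * (V ^ (α / n) * (C1 * (X * B) * V)) := by
        gcongr
        · exact hG hAt
        · exact hF hBt
    _ = C1 * C2 * (V ^ (α / n + 1 - 1 / r - 1 / s) * A * B) * (V ^ θ * X) * Y * V := by
        rw [hVθ]; ring
    _ ≤ C1 * C2 * T * (H ^ ((1 - r * (1 - 1 / s)) / r) * X ^ (r * (1 - 1 / s))) * Y * V := by
        gcongr
    _ = _ := by push_cast; ring

/-- After `i` levels the length factor has shrunk by `2 ^ (-α * i)` while the average has moved by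
at most `i * 2 ^ n`; the geometric decay wins. -/
theorem exists_sum_len_rpow_le {α : ℝ} (hα : 0 < α) :
    ∃ C : ℝ≥0, 0 < C ∧ ∀ (D : Grid n) (b : E → ℝ), LocallyIntegrable b → bmoNorm b ≤ 1 →
      ∀ (k K : ℕ) (x : E), ∑ j ∈ Finset.Ico k K, D.len j ^ α * (1 + |b x - D.avg b j x|) ≤
        C * (D.len k ^ α * (1 + |b x - D.avg b k x|)) := by
  set q : ℝ := 2⁻¹ ^ α with hq
  have hq0 : 0 ≤ q := by positivity
  have hq1 : q < 1 := Real.rpow_lt_one (by norm_num) (by norm_num) hα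
  have hsum : Summable fun i : ℕ => q ^ i * (1 + i * 2 ^ n) := by
    have h1 := summable_geometric_of_lt_one hq0 hq1
    have h2 := summable_pow_mul_geometric_of_norm_lt_one 1 (R := ℝ) (r := q)
      (by rwa [Real.norm_of_nonneg hq0])
    refine (h1.add (h2.mul_right (2 ^ n))).congr fun i => ?_
    ring
  have hnn : ∀ i : ℕ, 0 ≤ q ^ i * (1 + i * 2 ^ n) := fun i => by positivity
  refine ⟨(∑' i : ℕ, q ^ i * (1 + i * 2 ^ n)).toNNReal + 1, by positivity,
    fun D b hb hbmo k K x => ?_⟩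
  have hL := D.len_pos k
  rw [Finset.sum_Ico_eq_sum_range]
  calc ∑ i ∈ Finset.range (K - k), D.len (k + i) ^ α * (1 + |b x - D.avg b (k + i) x|)
      ≤ ∑ i ∈ Finset.range (K - k), q ^ i * (1 + i * 2 ^ n) *
        (D.len k ^ α * (1 + |b x - D.avg b k x|)) := by
        refine Finset.sum_le_sum fun i _ => ?_
        have e1 : D.len (k + i) ^ α = D.len k ^ α * q ^ i := by
          rw [len_add, div_eq_mul_inv, ← inv_pow, Real.mul_rpow hL.le (by positivity), hq,
            ← Real.rpow_natCast, ← Real.rpow_mul (by norm_num), mul_comm (i : ℝ),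
            Real.rpow_mul (by norm_num), Real.rpow_natCast]
        have e2 := abs_avg_add_sub_le (D := D) hb hbmo k i x
        have e3 := abs_sub_le (b x) (D.avg b k x) (D.avg b (k + i) x)
        rw [abs_sub_comm (D.avg b k x)] at e3
        have e4 : 1 + |b x - D.avg b (k + i) x| ≤
            (1 + i * 2 ^ n) * (1 + |b x - D.avg b k x|) := by
          have : 0 ≤ (i : ℝ) * 2 ^ n * |b x - D.avg b k x| := by positivity
          nlinarith
        calc _ ≤ D.len k ^ α * q ^ i * ((1 + i * 2 ^ n) * (1 + |b x - D.avg b k x|)) := by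
              rw [e1]; gcongr
          _ = _ := by ring
    _ = (∑ i ∈ Finset.range (K - k), q ^ i * (1 + i * 2 ^ n)) *
        (D.len k ^ α * (1 + |b x - D.avg b k x|)) := (Finset.sum_mul _ _ _).symm
    _ ≤ _ := by
        refine mul_le_mul_of_nonneg_right ?_ (by positivity)
        push_cast
        rw [Real.coe_toNNReal _ (tsum_nonneg hnn)]
        linarith [hsum.sum_le_tsum (Finset.range (K - k)) fun i _ => hnn i]

end Grid

/-! ### Stopping cells and the dyadic bilinear form -/

namespace Grid

variable {D : Grid n}

/-- The stopping argument for the averages of `G`: the cells inside a given cell on which the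
average of `G` at least doubles fill at most half of it. -/
theorem volume_le_two_mul_diff_stopping {G : E → ℝ≥0∞} {k K : ℕ} {x : E}
    (h0 : D.lavg G k x ≠ 0) :
    volume (D.cell k x) ≤ 2 * volume (D.cell k x \ ⋃ j, {y | y ∈ D.cell k x ∧ (k ≤ j ∧ j < K) ∧
      2 * D.lavg G k x < D.lavg G j y}) := by
  set B : ℕ → Set E := fun j => {y | y ∈ D.cell k x ∧ (k ≤ j ∧ j < K) ∧
      2 * D.lavg G k x < D.lavg G j y} with hB
  have hsat : ∀ j, D.Saturated j (B j) := by
    rintro j y z hyz ⟨h1, h2, h3⟩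
    refine ⟨(saturated_cell k x).mono h2.1 hyz h1, h2, ?_⟩
    rwa [← lavg_congr G hyz]
  have hBP : (⋃ j, B j) ⊆ D.cell k x := Set.iUnion_subset fun j y hy => hy.1
  have hUm : MeasurableSet (⋃ j, B j) := MeasurableSet.iUnion fun j => (hsat j).measurableSet
  have hV := D.volume_cell_ne_top k x
  have hhalf : 2 * volume (⋃ j, B j) ≤ volume (D.cell k x) := by
    -- Chebyshev's inequality has to be divided by the average; if that is infinite, nothing exceeds
    -- it and there are no stopping cells.
    by_cases ht : D.lavg G k x = ∞
    · have : (⋃ j, B j) = ∅ := by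
        refine Set.iUnion_eq_empty.2 fun j => Set.eq_empty_of_forall_notMem fun y hy => ?_
        have := hy.2.2
        rw [ht] at this
        simp at this
      rw [this]
      simp
    have h1 := mul_volume_iUnion_le hsat (g := G) (t := 2 * D.lavg G k x) fun j y hy => by
      rw [← lavg_mul_volume]
      gcongr
      exact hy.2.2.le
    have h2 := h1.trans (lintegral_mono_set hBP)
    rw [← lavg_mul_volume, mul_comm 2, mul_assoc] at h2
    exact (ENNReal.mul_le_mul_iff_right h0 ht).1 h2
  have hadd := measure_inter_add_sdiff (μ := volume) (D.cell k x) hUm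
  rw [Set.inter_eq_self_of_subset_right hBP] at hadd
  have hUt : volume (⋃ j, B j) ≠ ∞ := ne_top_of_le_ne_top hV (measure_mono hBP)
  rw [← hadd, two_mul] at hhalf
  have h3 := (ENNReal.add_le_add_iff_left hUt).1 hhalf
  rw [← hadd, two_mul]
  gcongr

/-- The bound for the dyadic bilinear form on a cell, restricted to the levels from `k` up to `K`. -/
theorem exists_sum_cell_le (hn : n ≠ 0) {α r s δ : ℝ} (hα : 0 < α) (hr : 1 < r) (hs : 1 < s)
    (hδ : 0 < δ) (hrs : r * (1 - 1 / s) ≤ 1) :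
    ∃ C : ℝ≥0, ∀ (D : Grid n) (b w v h g : E → ℝ) (T : ℝ≥0∞), Admissible α r s δ b w v h g T →
      ∀ (K d k : ℕ), k + d = K → ∀ (x : E),
        ∫⁻ y in D.cell k x, ∑ j ∈ Finset.Ico k K, ENNReal.ofReal (D.len j ^ α *
          (1 + |b y - D.avg b j y|) * (h y * w y)) *
            D.lavg (fun z => ENNReal.ofReal (g z * v z)) j y ≤
        ∫⁻ y in D.cell k x, C * T * (∫⁻ x, ‖h x‖ₑ ^ r) ^ ((1 - r * (1 - 1 / s)) / r) *
          (D.luxMax (dualBump r δ) h y ^ (r * (1 - 1 / s)) * D.luxMax (dualBump s δ) g y) := by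
  obtain ⟨C1, hC1⟩ := exists_lavg_mul_lintegral_le (n := n) (α := α) hn hr hs hδ hrs
  obtain ⟨C2, hC20, hC2⟩ := exists_sum_len_rpow_le (n := n) hα
  refine ⟨4 * C2 * C1, fun D b w v h g T hA K d => ?_⟩
  have hb := hA.locallyIntegrable
  set G : E → ℝ≥0∞ := fun z => ENNReal.ofReal (g z * v z) with hG
  set N := D.luxMax (dualBump r δ) h
  set N' := D.luxMax (dualBump s δ) g
  have hNm : Measurable N := measurable_luxMax _ _
  have hNm' : Measurable N' := measurable_luxMax _ _
  set ρ := r * (1 - 1 / s) with hρ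
  have hρ0 : 0 ≤ ρ := by
    have : 1 / s ≤ 1 := by rw [div_le_one (by linarith)]; exact hs.le
    exact mul_nonneg (by linarith) (by linarith)
  set S : ℝ≥0∞ := T * (∫⁻ x, ‖h x‖ₑ ^ r) ^ ((1 - ρ) / r) with hS
  set ψ : E → ℝ≥0∞ := fun y => ((4 * C2 * C1 : ℝ≥0) : ℝ≥0∞) * T *
    (∫⁻ x, ‖h x‖ₑ ^ r) ^ ((1 - ρ) / r) * (N y ^ ρ * N' y) with hψ
  induction d using Nat.strong_induction_on with
  | _ d ih =>
  intro k hk x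
  -- A zero average would defeat the estimate of the stopping cells, but then all finer averages
  -- vanish too.
  by_cases hG0 : D.lavg G k x = 0
  · refine (le_of_eq ?_).trans zero_le
    rw [← nonpos_iff_eq_zero]
    calc _ ≤ ∫⁻ y in D.cell k x, 0 := by
          refine setLIntegral_mono' (D.measurableSet_cell k x) fun y hy => ?_
          refine (Finset.sum_eq_zero fun j hj => ?_).le
          have hsub : D.cell j y ⊆ D.cell k x := by
            rw [← D.cell_eq hy]
            exact D.cell_subset (Finset.mem_Ico.1 hj).1 y
          have h1 : ∫⁻ z in D.cell k x, G z = 0 := by rw [← lavg_mul_volume, hG0, zero_mul]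
          have h2 : ∫⁻ z in D.cell j y, G z = 0 :=
            le_antisymm ((lintegral_mono_set hsub).trans h1.le) zero_le
          rw [lavg, h2, ENNReal.zero_div, mul_zero]
      _ = 0 := by simp
  set B : ℕ → Set E := fun j => {y | y ∈ D.cell k x ∧ (k ≤ j ∧ j < K) ∧
      2 * D.lavg G k x < D.lavg G j y} with hB
  have hsat : ∀ j, D.Saturated j (B j) := by
    rintro j y z hyz ⟨h1, h2, h3⟩
    refine ⟨(saturated_cell k x).mono h2.1 hyz h1, h2, ?_⟩
    rwa [← lavg_congr G hyz]
  have hlt : ∀ j, ∀ y ∈ B j, k < j := by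
    rintro j y ⟨h1, h2, h3⟩
    refine lt_of_le_of_ne h2.1 ?_
    rintro rfl
    rw [lavg_congr G (show D.idx k y = D.idx k x from h1), two_mul] at h3
    exact not_lt.2 le_self_add h3
  have hUm : MeasurableSet (⋃ j, B j) := MeasurableSet.iUnion fun j => (hsat j).measurableSet
  have hBP : (⋃ j, B j) ⊆ D.cell k x := Set.iUnion_subset fun j y hy => hy.1
  have hhw : ∀ y, 0 ≤ h y * w y := fun y => mul_nonneg (hA.h_nonneg y) (hA.w_nonneg y)
  have hterm : ∀ j y, 0 ≤ D.len j ^ α * (1 + |b y - D.avg b j y|) * (h y * w y) := fun j y => by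
    have := D.len_pos j
    have := hhw y
    positivity
  set W : E → ℝ≥0∞ := fun y => ENNReal.ofReal (C2 * (D.len k ^ α * (1 + |b y - D.avg b k y|)) *
    (h y * w y)) with hW
  have hWm : AEMeasurable W := by
    have hSm : AEMeasurable fun y => 1 + |b y - D.avg b k y| :=
      (continuous_abs.measurable.comp_aemeasurable
        (hb.aestronglyMeasurable.aemeasurable.sub (measurable_avg b k).aemeasurable)).const_add 1
    exact (((hSm.const_mul _).const_mul _).mul
      (hA.aemeasurable_h.mul hA.aemeasurable_w)).ennreal_ofReal
  -- Before stopping, each average of `G` is at most twice the first, and the remaining sum over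
  -- levels collapses to its top term.
  have hpartial : ∀ i y, (∀ j, k ≤ j → j < i → D.lavg G j y ≤ 2 * D.lavg G k x) →
      ∑ j ∈ Finset.Ico k i, ENNReal.ofReal (D.len j ^ α *
        (1 + |b y - D.avg b j y|) * (h y * w y)) * D.lavg G j y ≤
      2 * D.lavg G k x * W y := by
    intro i y hy
    calc _ ≤ ∑ j ∈ Finset.Ico k i, ENNReal.ofReal (D.len j ^ α *
          (1 + |b y - D.avg b j y|) * (h y * w y)) * (2 * D.lavg G k x) := by
          refine Finset.sum_le_sum fun j hj => ?_
          rw [Finset.mem_Ico] at hj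
          gcongr
          exact hy j hj.1 hj.2
      _ = 2 * D.lavg G k x * ENNReal.ofReal ((∑ j ∈ Finset.Ico k i, D.len j ^ α *
          (1 + |b y - D.avg b j y|)) * (h y * w y)) := by
          rw [← Finset.sum_mul, ← ENNReal.ofReal_sum_of_nonneg fun j _ => hterm j y,
            ← Finset.sum_mul, mul_comm]
      _ ≤ _ := by
          gcongr
          refine ENNReal.ofReal_le_ofReal (mul_le_mul_of_nonneg_right ?_ (hhw y))
          exact hC2 D b hb hA.bmoNorm_le k i y
  have key := lintegral_stopping_le (D := D) hsat (D.measurableSet_cell k x)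
    (fun j y hy => hy.1)
    (φ := fun y => ∑ j ∈ Finset.Ico k K, ENNReal.ofReal (D.len j ^ α *
      (1 + |b y - D.avg b j y|) * (h y * w y)) * D.lavg G j y)
    (φ' := fun i y => ∑ j ∈ Finset.Ico i K, ENNReal.ofReal (D.len j ^ α *
      (1 + |b y - D.avg b j y|) * (h y * w y)) * D.lavg G j y)
    (a := fun y => 2 * D.lavg G k x * W y) (ψ := ψ) (c := 1) (hWm.const_mul _) ENNReal.one_ne_top
    ?_ ?_ ?_
  · refine key.trans ?_
    -- The integral of `ψ` over the stopping cells is used up by the induction hypothesis. The top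
    -- cell has to be paid for by the part outside them.
    rw [one_mul, ← lintegral_inter_add_sdiff ψ (D.cell k x) hUm,
      Set.inter_eq_self_of_subset_right hBP, add_comm]
    refine add_le_add le_rfl ?_
    have e1 : ∫⁻ y in D.cell k x, 2 * D.lavg G k x * W y = 2 * C2 * (D.lavg G k x *
        (ENNReal.ofReal (D.len k ^ α) *
          ∫⁻ y in D.cell k x, ENNReal.ofReal ((1 + |b y - D.avg b k y|) * h y * w y))) := by
      have hl : 0 ≤ D.len k ^ α := by have := D.len_pos k; positivity
      rw [lintegral_const_mul'' _ hWm.restrict]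
      have : ∀ y, W y = C2 * ENNReal.ofReal (D.len k ^ α) *
          ENNReal.ofReal ((1 + |b y - D.avg b k y|) * h y * w y) := fun y => by
        rw [← ENNReal.ofReal_coe_nnreal, ← ENNReal.ofReal_mul (by positivity),
          ← ENNReal.ofReal_mul (by positivity)]
        simp only [hW]
        congr 1
        ring
      simp_rw [this]
      rw [lintegral_const_mul' _ _ (ENNReal.mul_ne_top ENNReal.coe_ne_top ENNReal.ofReal_ne_top)]
      ring
    rw [e1]
    set X := luxNorm (dualBump r δ) (D.cell k x) h
    set Y := luxNorm (dualBump s δ) (D.cell k x) g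
    calc _ ≤ 2 * C2 * (C1 * T * (∫⁻ x, ‖h x‖ₑ ^ r) ^ ((1 - ρ) / r) *
          ((X ^ ρ * Y) * volume (D.cell k x))) := mul_le_mul_right (hC1 D b w v h g T hA k x) _
      -- The second factor 2 of the constant `4 * C2 * C1`: at least half of the cell lies outside
      -- the stopping cells, and there the maximal functions dominate `X` and `Y`.
      _ ≤ 2 * C2 * (C1 * T * (∫⁻ x, ‖h x‖ₑ ^ r) ^ ((1 - ρ) / r) *
          ((X ^ ρ * Y) * (2 * volume (D.cell k x \ ⋃ j, B j)))) := by
          gcongr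
          exact volume_le_two_mul_diff_stopping hG0
      _ = ∫⁻ y in D.cell k x \ ⋃ j, B j, ((4 * C2 * C1 : ℝ≥0) : ℝ≥0∞) * T *
          (∫⁻ x, ‖h x‖ₑ ^ r) ^ ((1 - ρ) / r) * (X ^ ρ * Y) := by
          rw [setLIntegral_const]
          push_cast
          rw [show (4 : ℝ≥0∞) = 2 * 2 by norm_num]
          ring
      _ ≤ _ := by
          refine setLIntegral_mono' ((D.measurableSet_cell k x).diff hUm) fun y hy => ?_
          refine mul_le_mul_right (mul_le_mul' (ENNReal.rpow_le_rpow ?_ hρ0) ?_) _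
          · exact luxNorm_cell_le_luxMax _ _ k hy.1
          · exact luxNorm_cell_le_luxMax _ _ k hy.1
  · intro y hy hn
    refine hpartial K y fun j hkj hjK => ?_
    by_contra hcon
    exact hn j ⟨hy, ⟨hkj, hjK⟩, not_le.1 hcon⟩
  · intro i y hy hn
    have hki := hlt i y hy
    have hiK := hy.2.1.2
    rw [one_mul, ← Finset.sum_Ico_consecutive _ hki.le hiK.le]
    refine add_le_add (hpartial i y fun j hkj hji => ?_) le_rfl
    by_contra hcon
    exact hn j hji ⟨hy.1, ⟨hkj, hji.trans hiK⟩, not_le.1 hcon⟩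
  · intro j y hy _
    have := hlt j y hy
    have := hy.2.1.2
    exact ih (K - j) (by omega) j (by omega) y

/-- The cells of level 0 partition the space. Hölder with `s'` and `s` fits because `ρ = r / s'`
turns the first factor into the `r`-th power of the maximal function; the exponents of `‖h‖`
recombine through `(1 - ρ) / r + 1 / s' = 1 / r`. -/
theorem exists_bilinear_le (hn : n ≠ 0) {α r s δ : ℝ} (hα : 0 < α) (hr : 1 < r) (hs : 1 < s)
    (hδ : 0 < δ) (hrs : r * (1 - 1 / s) ≤ 1) :
    ∃ C : ℝ≥0, ∀ (D : Grid n) (b w v h g : E → ℝ) (T : ℝ≥0∞), Admissible α r s δ b w v h g T →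
      ∀ K : ℕ,
        ∫⁻ y, ∑ j ∈ Finset.range K, ENNReal.ofReal (D.len j ^ α *
          (1 + |b y - D.avg b j y|) * (h y * w y)) *
            D.lavg (fun z => ENNReal.ofReal (g z * v z)) j y ≤
        C * T * ((∫⁻ x, ‖h x‖ₑ ^ r) ^ (1 / r) * (∫⁻ x, ‖g x‖ₑ ^ s) ^ (1 / s)) := by
  obtain ⟨C, hC⟩ := exists_sum_cell_le (n := n) hn hα hr hs hδ hrs
  obtain ⟨C1, hC1⟩ := exists_lintegral_luxMax_rpow_le (n := n) hr hδ
  obtain ⟨C2, hC2⟩ := exists_lintegral_luxMax_rpow_le (n := n) hs hδ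
  have hs0 : 0 < s := by linarith
  have hr0 : 0 < r := by linarith
  have hs1 : 0 < 1 - 1 / s := by
    have : 1 / s < 1 := by rw [div_lt_one hs0]; exact hs
    linarith
  refine ⟨C * C1 ^ (1 - 1 / s) * C2 ^ (1 / s), fun D b w v h g T hA K => ?_⟩
  set N := D.luxMax (dualBump r δ) h
  set N' := D.luxMax (dualBump s δ) g
  have hNm : Measurable N := measurable_luxMax _ _
  have hNm' : Measurable N' := measurable_luxMax _ _
  set ρ := r * (1 - 1 / s) with hρ
  have hρ0 : 0 < ρ := mul_pos hr0 hs1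
  set H := ∫⁻ x, ‖h x‖ₑ ^ r with hH
  have hsat : D.Saturated 0 (Set.univ : Set E) := fun _ _ _ _ => Set.mem_univ _
  have h1 := hsat.lintegral_le (φ := fun y => ∑ j ∈ Finset.range K, ENNReal.ofReal (D.len j ^ α *
      (1 + |b y - D.avg b j y|) * (h y * w y)) *
        D.lavg (fun z => ENNReal.ofReal (g z * v z)) j y)
    (ψ := fun y => C * T * H ^ ((1 - ρ) / r) * (N y ^ ρ * N' y)) fun x _ => by
      simpa only [Finset.range_eq_Ico] using hC D b w v h g T hA K K 0 (zero_add K) x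
  rw [setLIntegral_univ, setLIntegral_univ,
    lintegral_const_mul (f := fun y => N y ^ ρ * N' y) _ ((hNm.pow_const ρ).mul hNm')] at h1
  have hconj : (1 - 1 / s)⁻¹.HolderConjugate s := by
    have := Real.HolderConjugate.conjExponent hs
    have e : (1 - 1 / s)⁻¹ = Real.conjExponent s := by
      rw [Real.conjExponent]; field_simp
    rw [e]
    exact this.symm
  have h2 := ENNReal.lintegral_mul_le_Lp_mul_Lq volume hconj (hNm.pow_const ρ).aemeasurable
    hNm'.aemeasurable
  have h3 : ∫⁻ x, (N x ^ ρ) ^ (1 - 1 / s)⁻¹ = ∫⁻ x, N x ^ r := by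
    refine lintegral_congr fun x => ?_
    rw [← ENNReal.rpow_mul, hρ, mul_assoc, mul_inv_cancel₀ hs1.ne', mul_one]
  rw [h3, one_div, inv_inv] at h2
  refine h1.trans ?_
  calc _ ≤ C * T * H ^ ((1 - ρ) / r) * ((∫⁻ x, N x ^ r) ^ (1 - 1 / s) *
        (∫⁻ x, N' x ^ s) ^ (1 / s)) := by
        gcongr
        exact h2
    _ ≤ C * T * H ^ ((1 - ρ) / r) * ((C1 * H) ^ (1 - 1 / s) *
        (C2 * ∫⁻ x, ‖g x‖ₑ ^ s) ^ (1 / s)) := by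
        gcongr
        · exact hC1 D h hA.aemeasurable_h
        · exact hC2 D g hA.aemeasurable_g
    _ = C * C1 ^ (1 - 1 / s) * C2 ^ (1 / s) * T * ((H ^ ((1 - ρ) / r) * H ^ (1 - 1 / s)) *
        (∫⁻ x, ‖g x‖ₑ ^ s) ^ (1 / s)) := by
        rw [ENNReal.mul_rpow_of_nonneg _ _ hs1.le, ENNReal.mul_rpow_of_nonneg _ _ (by positivity)]
        ring
    _ = _ := by
        have e : (1 - ρ) / r + (1 - 1 / s) = 1 / r := by
          rw [hρ]; field_simp; ring
        rw [← ENNReal.rpow_add_of_nonneg _ _ (div_nonneg (by linarith) hr0.le) hs1.le, e]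
        push_cast
        rw [ENNReal.coe_rpow_of_nonneg _ hs1.le, ENNReal.coe_rpow_of_nonneg _ (by positivity)]

end Grid

/-! ### The one-third trick -/

/-- If a point of the grid and a point of the shifted grid both separated `a` from `b`, they would
be less than `l / 3` apart. This forces `3 * (m - m') = 2 ^ k`, which is impossible. The shift `2 ^
k * l / 3` allows one fixed shift to serve all levels of a grid. -/
theorem floor_div_eq_or_floor_sub_div_eq {a b l : ℝ} (hl : 0 < l) (hab : |a - b| < l / 3) (k : ℕ) :
    ⌊a / l⌋ = ⌊b / l⌋ ∨ ⌊(a - 2 ^ k * l / 3) / l⌋ = ⌊(b - 2 ^ k * l / 3) / l⌋ := by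
  wlog h : a ≤ b generalizing a b
  · rw [abs_sub_comm] at hab
    simpa only [eq_comm] using this hab (not_le.1 h).le
  by_contra! hcon
  obtain ⟨h1, h2⟩ := hcon
  have e : ∀ c : ℝ, (c - 2 ^ k * l / 3) / l = c / l - 2 ^ k / 3 := fun c => by
    field_simp
  rw [e, e] at h2
  have hle : a / l ≤ b / l := by gcongr
  have hd : b / l < a / l + 1 / 3 := by
    rw [abs_sub_comm, abs_of_nonneg (by linarith)] at hab
    rw [div_lt_iff₀ hl, add_mul, div_mul_cancel₀ _ hl.ne']
    linarith
  have h1' := lt_of_le_of_ne (Int.floor_le_floor hle) h1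
  have h2' := lt_of_le_of_ne (Int.floor_le_floor (sub_le_sub_right hle (2 ^ k / 3))) h2
  rw [Int.floor_lt] at h1' h2'
  have h3 := Int.floor_le (b / l)
  have h4 := Int.floor_le (b / l - 2 ^ k / 3)
  set m := ⌊b / l⌋
  set m' := ⌊b / l - 2 ^ k / 3⌋
  have h5 : (3 * (m - m') - 2 ^ k : ℝ) < 1 := by linarith
  have h6 : (-1 : ℝ) < (3 * (m - m') - 2 ^ k : ℝ) := by linarith
  have h5' : 3 * (m - m') - 2 ^ k < 1 := by exact_mod_cast h5
  have h6' : -1 < 3 * (m - m') - 2 ^ k := by exact_mod_cast h6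
  have h7 : (3 : ℤ) ∣ 2 ^ k := ⟨m - m', by omega⟩
  have h8 := Int.Prime.dvd_pow' (p := 3) Nat.prime_three h7
  omega

/-- The grids with side length `2 ^ (N + 2)`, shifted by a third of that length in the directions
given by `ε`. -/
def thirdGrid (N : ℕ) (ε : Fin n → Bool) : Grid n where
  side := 2 ^ (N + 2)
  origin i := if ε i then 2 ^ (N + 2) / 3 else 0
  side_pos := by positivity

theorem exists_idx_thirdGrid_eq {N : ℕ} {x y : E} (h1 : (2 ^ N : ℝ)⁻¹ ≤ ‖x - y‖)
    (h2 : ‖x - y‖ ≤ 2 ^ N) :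
    ∃ ε : Fin n → Bool, ∃ k < 2 * N + 2, (thirdGrid N ε).idx k x = (thirdGrid N ε).idx k y ∧
      (thirdGrid N ε).len k ≤ 6 * ‖x - y‖ := by
  set t := ‖x - y‖
  set l : ℕ → ℝ := fun k => 2 ^ (N + 2) / 2 ^ k with hl
  have hlast : l (2 * N + 2) ≤ 3 * t := by
    have : l (2 * N + 2) = (2 ^ N : ℝ)⁻¹ := by
      simp only [hl, pow_add, two_mul]
      field_simp
    have h0 : (0 : ℝ) < (2 ^ N)⁻¹ := by positivity
    linarith
  -- The level sought is the last with length above `3 * t`. It exists because `l 0 = 4 * 2 ^ N > 3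
  -- * t`, and halving once more gives `l k ≤ 6 * t`.
  have hex : ∃ m, l m ≤ 3 * t := ⟨_, hlast⟩
  classical
  have hm0 : Nat.find hex ≠ 0 := by
    intro h0
    have := Nat.find_spec hex
    rw [h0] at this
    simp only [hl, pow_zero, div_one, pow_add] at this
    have h3 : (0 : ℝ) < 2 ^ N := by positivity
    linarith
  obtain ⟨k, hk⟩ := Nat.exists_eq_succ_of_ne_zero hm0
  have hk1 : l (k + 1) ≤ 3 * t := by
    have := Nat.find_spec hex
    rwa [hk] at this
  have hk2 : 3 * t < l k := not_le.1 (Nat.find_min hex (by omega))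
  have hk3 : k < 2 * N + 2 := by
    have := Nat.find_min' hex hlast
    omega
  have hlk : 0 < l k := by simp only [hl]; positivity
  have hkk : 2 ^ k * l k = 2 ^ (N + 2) := by
    simp only [hl]
    field_simp
  have hcoord : ∀ i, |x i - y i| < l k / 3 := fun i => by
    have := PiLp.norm_apply_le (x - y) i
    rw [Real.norm_eq_abs, PiLp.sub_apply] at this
    linarith
  have hch : ∀ i, ∃ e : Bool, ⌊(x i - if e then 2 ^ (N + 2) / 3 else 0) / l k⌋ =
      ⌊(y i - if e then 2 ^ (N + 2) / 3 else 0) / l k⌋ := fun i => by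
    rcases floor_div_eq_or_floor_sub_div_eq hlk (hcoord i) k with h | h
    · exact ⟨false, by simpa using h⟩
    · rw [hkk] at h
      exact ⟨true, by simpa using h⟩
  choose ε hε using hch
  refine ⟨ε, k, hk3, funext fun i => hε i, ?_⟩
  have : l k = 2 * l (k + 1) := by
    simp only [hl, pow_succ]
    field_simp
  change l k ≤ 6 * t
  linarith

theorem one_div_norm_rpow_le {α : ℝ} (hαn : α < n) {N : ℕ} {x y : E}
    (h1 : (2 ^ N : ℝ)⁻¹ ≤ ‖x - y‖) (h2 : ‖x - y‖ ≤ 2 ^ N) :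
    ∃ ε : Fin n → Bool, ∃ k < 2 * N + 2, (thirdGrid N ε).idx k x = (thirdGrid N ε).idx k y ∧
      1 / ‖x - y‖ ^ ((n : ℝ) - α) ≤ 6 ^ ((n : ℝ) - α) *
        ((thirdGrid N ε).len k ^ α / (thirdGrid N ε).len k ^ n) := by
  obtain ⟨ε, k, hk, hidx, hlen⟩ := exists_idx_thirdGrid_eq h1 h2
  refine ⟨ε, k, hk, hidx, ?_⟩
  set l := (thirdGrid N ε).len k
  have hl : 0 < l := (thirdGrid N ε).len_pos k
  have ht : 0 < ‖x - y‖ := lt_of_lt_of_le (by positivity) h1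
  have hd : 0 < (n : ℝ) - α := by linarith
  have e : l ^ α / l ^ n = 1 / l ^ ((n : ℝ) - α) := by
    rw [Real.rpow_sub hl, Real.rpow_natCast]
    field_simp
  rw [e, mul_one_div, div_le_div_iff₀ (by positivity) (by positivity), one_mul,
    ← Real.mul_rpow (by norm_num) ht.le]
  exact Real.rpow_le_rpow hl.le hlen hd.le

/-! ### From the double integral to dyadic forms -/

/-- The oscillation of `b` may fall on either function; this symmetry reduces one case to the other.
-/
theorem Admissible.symm {α r s δ : ℝ} {b w v h g : E → ℝ} {T : ℝ≥0∞}
    (H : Admissible α r s δ b w v h g T) : Admissible α s r δ b v w g h T where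
  locallyIntegrable := H.locallyIntegrable
  bmoNorm_le := H.bmoNorm_le
  aemeasurable_w := H.aemeasurable_v
  aemeasurable_v := H.aemeasurable_w
  aemeasurable_h := H.aemeasurable_g
  aemeasurable_g := H.aemeasurable_h
  w_nonneg := H.v_nonneg
  v_nonneg := H.w_nonneg
  h_nonneg := H.g_nonneg
  g_nonneg := H.h_nonneg
  ne_top := H.ne_top
  bump_le a l hl := by
    rw [mul_right_comm, sub_right_comm]
    exact H.bump_le a l hl
  h_lt_top := H.g_lt_top
  g_lt_top := H.h_lt_top

namespace Grid

variable {D : Grid n}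

theorem measurableSet_idx_eq (k : ℕ) :
    MeasurableSet {z : E × E | D.idx k z.1 = D.idx k z.2} :=
  measurableSet_eq_fun ((D.measurable_idx k).comp measurable_fst)
    ((D.measurable_idx k).comp measurable_snd)

theorem lintegral_prod_idx_eq {A B : E → ℝ≥0∞} (hA : AEMeasurable A) (hB : AEMeasurable B)
    (k : ℕ) :
    ∫⁻ z : E × E, {z : E × E | D.idx k z.1 = D.idx k z.2}.indicator
      (fun z => A z.1 * B z.2) z ∂(volume.prod volume) =
    ∫⁻ x, A x * ∫⁻ y in D.cell k x, B y := by
  have hm : AEMeasurable (fun z : E × E => A z.1 * B z.2) (volume.prod volume) :=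
    hA.comp_fst.mul hB.comp_snd
  rw [lintegral_prod _ (hm.indicator (measurableSet_idx_eq k))]
  refine lintegral_congr fun x => ?_
  rw [← lintegral_indicator (D.measurableSet_cell k x), ← lintegral_const_mul'' _
    (hB.indicator (D.measurableSet_cell k x))]
  refine lintegral_congr fun y => ?_
  by_cases h : D.idx k x = D.idx k y
  · rw [Set.indicator_of_mem (show (x, y) ∈ _ from h),
      Set.indicator_of_mem (show y ∈ D.cell k x from h.symm)]
  · rw [Set.indicator_of_notMem (show (x, y) ∉ _ from h),
      Set.indicator_of_notMem (show y ∉ D.cell k x from fun h' => h h'.symm), mul_zero]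

theorem lintegral_prod_idx_eq_symm {A B : E → ℝ≥0∞} (hA : AEMeasurable A) (hB : AEMeasurable B)
    (k : ℕ) :
    ∫⁻ z : E × E, {z : E × E | D.idx k z.1 = D.idx k z.2}.indicator
      (fun z => A z.2 * B z.1) z ∂(volume.prod volume) =
    ∫⁻ x, A x * ∫⁻ y in D.cell k x, B y := by
  rw [← lintegral_prod_idx_eq hA hB, ← lintegral_prod_swap]
  refine lintegral_congr fun z => ?_
  by_cases h : D.idx k z.1 = D.idx k z.2
  · rw [Set.indicator_of_mem (show z.swap ∈ {z : E × E | D.idx k z.1 = D.idx k z.2} from h.symm),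
      Set.indicator_of_mem (show z ∈ {z : E × E | D.idx k z.1 = D.idx k z.2} from h)]
    rfl
  · rw [Set.indicator_of_notMem (show z.swap ∉ {z : E × E | D.idx k z.1 = D.idx k z.2} from
      fun h' => h h'.symm),
      Set.indicator_of_notMem (show z ∉ {z : E × E | D.idx k z.1 = D.idx k z.2} from h)]

theorem measurable_lavg (G : E → ℝ≥0∞) (k : ℕ) : Measurable (D.lavg G k) :=
  measurable_of_idx (D := D) k fun _ _ h => lavg_congr G h

theorem lintegral_cell_inv_mul (G : E → ℝ≥0∞) (k : ℕ) (x : E) :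
    ∫⁻ y in D.cell k x, (ENNReal.ofReal (D.len k) ^ n)⁻¹ * G y = D.lavg G k x := by
  have h := D.volume_cell_ne_zero k x
  rw [volume_cell] at h
  rw [lintegral_const_mul' _ _ (ENNReal.inv_ne_top.2 h), lavg, volume_cell, mul_comm,
    div_eq_mul_inv]

end Grid

/-- The integrand of the bilinear form of the commutator. -/
def commIntegrand (α : ℝ) (b F G : E → ℝ) (z : E × E) : ℝ≥0∞ :=
  ENNReal.ofReal ((1 + |b z.1 - b z.2|) * F z.2 * G z.1 * (1 / ‖z.1 - z.2‖ ^ ((n : ℝ) - α)))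

theorem le_sum_sum {ι : Type*} [Fintype ι] {f : ι → ℕ → ℝ≥0∞} (i : ι) {j K : ℕ} (hj : j < K) :
    f i j ≤ ∑ i, ∑ j ∈ Finset.range K, f i j :=
  (Finset.single_le_sum (f := f i) (fun _ _ => zero_le) (Finset.mem_range.2 hj)).trans
    (Finset.single_le_sum (f := fun i => ∑ j ∈ Finset.range K, f i j) (fun _ _ => zero_le)
      (Finset.mem_univ i))

open Grid in
-- Both points share a cell, so its average of `b` can be inserted in `|b x - b y|`. Summing over
-- all shifts and levels avoids any measurable choice of that cell.
theorem commIntegrand_le {α : ℝ} (hαn : α < n) (b : E → ℝ) {F G : E → ℝ} (hF : ∀ x, 0 ≤ F x)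
    (hG : ∀ x, 0 ≤ G x) {N : ℕ} {z : E × E} (h1 : (2 ^ N : ℝ)⁻¹ ≤ ‖z.1 - z.2‖)
    (h2 : ‖z.1 - z.2‖ ≤ 2 ^ N) :
    commIntegrand α b F G z ≤ ENNReal.ofReal (6 ^ ((n : ℝ) - α)) * ∑ ε : Fin n → Bool,
      ∑ j ∈ Finset.range (2 * N + 2),
        ({z : E × E | (thirdGrid N ε).idx j z.1 = (thirdGrid N ε).idx j z.2}.indicator (fun z =>
          ENNReal.ofReal ((thirdGrid N ε).len j ^ α *
            (1 + |b z.1 - (thirdGrid N ε).avg b j z.1|) * G z.1) *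
          ((ENNReal.ofReal ((thirdGrid N ε).len j) ^ n)⁻¹ * ENNReal.ofReal (F z.2))) z +
        {z : E × E | (thirdGrid N ε).idx j z.1 = (thirdGrid N ε).idx j z.2}.indicator (fun z =>
          ENNReal.ofReal ((thirdGrid N ε).len j ^ α *
            (1 + |b z.2 - (thirdGrid N ε).avg b j z.2|) * F z.2) *
          ((ENNReal.ofReal ((thirdGrid N ε).len j) ^ n)⁻¹ * ENNReal.ofReal (G z.1))) z) := by
  obtain ⟨ε, j, hj, hidx, hle⟩ := one_div_norm_rpow_le hαn h1 h2
  have hmem : z ∈ {z : E × E | (thirdGrid N ε).idx j z.1 = (thirdGrid N ε).idx j z.2} := hidx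
  refine le_trans ?_ (mul_le_mul_right (le_sum_sum ε hj) _)
  simp only [Set.indicator_of_mem hmem]
  set l := (thirdGrid N ε).len j with hl
  have hl0 : 0 < l := (thirdGrid N ε).len_pos j
  have havg := avg_congr (D := thirdGrid N ε) b hidx
  set m := (thirdGrid N ε).avg b j z.1
  rw [← havg]
  have hinv : (ENNReal.ofReal l ^ n)⁻¹ = ENNReal.ofReal ((l ^ n)⁻¹) := by
    rw [ENNReal.ofReal_inv_of_pos (by positivity), ENNReal.ofReal_pow hl0.le]
  have hF' := hF z.2
  have hG' := hG z.1
  have hlα : 0 ≤ l ^ α := by positivity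
  have hln : 0 ≤ (l ^ n)⁻¹ := by positivity
  rw [hinv, ← ENNReal.ofReal_mul hln, ← ENNReal.ofReal_mul hln, ← ENNReal.ofReal_mul (by positivity),
    ← ENNReal.ofReal_mul (by positivity), ← ENNReal.ofReal_add (by positivity) (by positivity),
    ← ENNReal.ofReal_mul (by positivity)]
  refine ENNReal.ofReal_le_ofReal ?_
  have h3 := abs_sub_le (b z.1) m (b z.2)
  rw [abs_sub_comm m] at h3
  calc _ ≤ ((1 + |b z.1 - m|) + (1 + |b z.2 - m|)) * F z.2 * G z.1 *
        (6 ^ ((n : ℝ) - α) * (l ^ α / l ^ n)) := by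
        refine mul_le_mul (mul_le_mul_of_nonneg_right (mul_le_mul_of_nonneg_right ?_ hF') hG') hle
          (by positivity) (by positivity)
        linarith
    _ = _ := by
        rw [div_eq_mul_inv]
        ring

theorem aemeasurable_commIntegrand (α : ℝ) {b F G : E → ℝ} (hb : AEMeasurable b)
    (hF : AEMeasurable F) (hG : AEMeasurable G) :
    AEMeasurable (commIntegrand α b F G) (volume.prod volume) := by
  have h1 : AEMeasurable (fun z : E × E => 1 + |b z.1 - b z.2|) (volume.prod volume) :=
    (continuous_abs.measurable.comp_aemeasurable (hb.comp_fst.sub hb.comp_snd)).const_add 1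
  have h2 : Measurable fun z : E × E => 1 / ‖z.1 - z.2‖ ^ ((n : ℝ) - α) := by fun_prop
  exact (((h1.mul hF.comp_snd).mul hG.comp_fst).mul h2.aemeasurable).ennreal_ofReal

open Grid in
theorem exists_lintegral_commIntegrand_le {α r s δ : ℝ} (hα : 0 < α) (hαn : α < n) (hr : 1 < r)
    (hs : 1 < s) (hδ : 0 < δ) (hrs : 1 ≤ 1 / r + 1 / s) :
    ∃ C : ℝ≥0, ∀ (b w v h g : E → ℝ) (T : ℝ≥0∞), Admissible α r s δ b w v h g T →
      ∫⁻ z, commIntegrand α b (fun y => h y * w y) (fun x => g x * v x) z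
        ∂((volume : Measure E).prod volume) ≤
        C * T * ((∫⁻ x, ‖h x‖ₑ ^ r) ^ (1 / r) * (∫⁻ x, ‖g x‖ₑ ^ s) ^ (1 / s)) := by
  have hn : n ≠ 0 := by
    rintro rfl
    rw [Nat.cast_zero] at hαn
    linarith
  have hr0 : 0 < r := by linarith
  have hs0 : 0 < s := by linarith
  have hρ1 : r * (1 - 1 / s) ≤ 1 := by
    have : r * (1 - 1 / s) ≤ r * (1 / r) := mul_le_mul_of_nonneg_left (by linarith) hr0.le
    rwa [mul_one_div_cancel hr0.ne'] at this
  have hρ2 : s * (1 - 1 / r) ≤ 1 := by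
    have : s * (1 - 1 / r) ≤ s * (1 / s) := mul_le_mul_of_nonneg_left (by linarith) hs0.le
    rwa [mul_one_div_cancel hs0.ne'] at this
  obtain ⟨C1, hC1⟩ := exists_bilinear_le hn hα hr hs hδ hρ1
  obtain ⟨C2, hC2⟩ := exists_bilinear_le hn hα hs hr hδ hρ2
  refine ⟨(6 ^ ((n : ℝ) - α)) * (Fintype.card (Fin n → Bool) * (C2 + C1)),
    fun b w v h g T hA => ?_⟩
  set F : E → ℝ := fun y => h y * w y with hFdef
  set G : E → ℝ := fun x => g x * v x with hGdef
  have hF : ∀ y, 0 ≤ F y := fun y => mul_nonneg (hA.h_nonneg y) (hA.w_nonneg y)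
  have hG : ∀ y, 0 ≤ G y := fun y => mul_nonneg (hA.g_nonneg y) (hA.v_nonneg y)
  have hFm : AEMeasurable F := hA.aemeasurable_h.mul hA.aemeasurable_w
  have hGm : AEMeasurable G := hA.aemeasurable_g.mul hA.aemeasurable_v
  have hbm := hA.locallyIntegrable.aestronglyMeasurable.aemeasurable
  set R : ℕ → Set (E × E) := fun N => {z | (2 ^ N : ℝ)⁻¹ ≤ ‖z.1 - z.2‖ ∧ ‖z.1 - z.2‖ ≤ 2 ^ N}
    with hR
  have hdm : Measurable fun z : E × E => ‖z.1 - z.2‖ := by fun_prop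
  have hRm : ∀ N, MeasurableSet (R N) := fun N =>
    MeasurableSet.inter (s₁ := {z : E × E | (2 ^ N : ℝ)⁻¹ ≤ ‖z.1 - z.2‖}) (s₂ := {z : E × E | ‖z.1 - z.2‖ ≤ 2 ^ N})
      (measurableSet_le measurable_const hdm) (measurableSet_le hdm measurable_const)
  have hRmono : Monotone R := fun N M hNM z hz => by
    have : (2 : ℝ) ^ N ≤ 2 ^ M := pow_le_pow_right₀ one_le_two hNM
    exact ⟨(inv_anti₀ (by positivity) this).trans hz.1, hz.2.trans this⟩
  have hfull : ∫⁻ z, commIntegrand α b F G z ∂((volume : Measure E).prod volume) =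
      ∫⁻ z in ⋃ N, R N, commIntegrand α b F G z ∂((volume : Measure E).prod volume) := by
    rw [← lintegral_indicator (MeasurableSet.iUnion hRm)]
    refine lintegral_congr fun z => ?_
    by_cases hz : z ∈ ⋃ N, R N
    · rw [Set.indicator_of_mem hz]
    · rw [Set.indicator_of_notMem hz]
      have hz0 : ‖z.1 - z.2‖ = 0 := by
        by_contra hne
        have hpos : 0 < ‖z.1 - z.2‖ := lt_of_le_of_ne (norm_nonneg _) (Ne.symm hne)
        obtain ⟨N1, hN1⟩ := pow_unbounded_of_one_lt ‖z.1 - z.2‖ (one_lt_two (α := ℝ))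
        obtain ⟨N2, hN2⟩ := pow_unbounded_of_one_lt (‖z.1 - z.2‖)⁻¹ (one_lt_two (α := ℝ))
        refine hz (Set.mem_iUnion.2 ⟨max N1 N2, ?_, ?_⟩)
        · rw [inv_le_comm₀ (by positivity) hpos]
          exact hN2.le.trans (pow_le_pow_right₀ one_le_two (le_max_right _ _))
        · exact hN1.le.trans (pow_le_pow_right₀ one_le_two (le_max_left _ _))
      -- On the diagonal the kernel is `1 / 0 = 0` by convention, so these points contribute
      -- nothing.
      rw [commIntegrand, hz0, Real.zero_rpow (by linarith)]
      simp
  -- Monotone convergence: the bound below does not depend on the truncation `N`, although the grids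
  -- do.
  rw [hfull, setLIntegral_iUnion_of_directed _ (directed_of_isDirected_le hRmono)]
  refine iSup_le fun N => ?_
  set S := (∫⁻ x, ‖h x‖ₑ ^ r) ^ (1 / r) * (∫⁻ x, ‖g x‖ₑ ^ s) ^ (1 / s) with hS
  have hAm : ∀ (D : Grid n) (j : ℕ) (U : E → ℝ), AEMeasurable U → AEMeasurable fun x =>
      ENNReal.ofReal (D.len j ^ α * (1 + |b x - D.avg b j x|) * U x) := fun D j U hU => by
    have hSm : AEMeasurable fun y => 1 + |b y - D.avg b j y| :=
      (continuous_abs.measurable.comp_aemeasurable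
        (hbm.sub (measurable_avg b j).aemeasurable)).const_add 1
    exact ((hSm.const_mul _).mul hU).ennreal_ofReal
  have hBm : ∀ (D : Grid n) (j : ℕ) (U : E → ℝ), AEMeasurable U → AEMeasurable fun x =>
      (ENNReal.ofReal (D.len j) ^ n)⁻¹ * ENNReal.ofReal (U x) := fun D j U hU =>
    hU.ennreal_ofReal.const_mul _
  have hsum : ∀ (D : Grid n) (U V : E → ℝ), AEMeasurable U → AEMeasurable V →
      ∑ j ∈ Finset.range (2 * N + 2), ∫⁻ x, ENNReal.ofReal (D.len j ^ α *
        (1 + |b x - D.avg b j x|) * U x) * ∫⁻ y in D.cell j x,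
          (ENNReal.ofReal (D.len j) ^ n)⁻¹ * ENNReal.ofReal (V y) =
      ∫⁻ x, ∑ j ∈ Finset.range (2 * N + 2), ENNReal.ofReal (D.len j ^ α *
        (1 + |b x - D.avg b j x|) * U x) * D.lavg (fun y => ENNReal.ofReal (V y)) j x :=
    fun D U V hU hV => by
      have hm : ∀ j, AEMeasurable fun x => ENNReal.ofReal (D.len j ^ α *
          (1 + |b x - D.avg b j x|) * U x) * D.lavg (fun y => ENNReal.ofReal (V y)) j x :=
        fun j => (hAm D j U hU).mul (measurable_lavg _ j).aemeasurable
      rw [lintegral_finsetSum' _ fun j _ => hm j]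
      refine Finset.sum_congr rfl fun j _ => lintegral_congr fun x => ?_
      rw [lintegral_cell_inv_mul]
  set I1 : (Fin n → Bool) → ℕ → E × E → ℝ≥0∞ := fun ε j =>
    {z : E × E | (thirdGrid N ε).idx j z.1 = (thirdGrid N ε).idx j z.2}.indicator (fun z =>
      ENNReal.ofReal ((thirdGrid N ε).len j ^ α *
        (1 + |b z.1 - (thirdGrid N ε).avg b j z.1|) * G z.1) *
      ((ENNReal.ofReal ((thirdGrid N ε).len j) ^ n)⁻¹ * ENNReal.ofReal (F z.2))) with hI1
  set I2 : (Fin n → Bool) → ℕ → E × E → ℝ≥0∞ := fun ε j =>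
    {z : E × E | (thirdGrid N ε).idx j z.1 = (thirdGrid N ε).idx j z.2}.indicator (fun z =>
      ENNReal.ofReal ((thirdGrid N ε).len j ^ α *
        (1 + |b z.2 - (thirdGrid N ε).avg b j z.2|) * F z.2) *
      ((ENNReal.ofReal ((thirdGrid N ε).len j) ^ n)⁻¹ * ENNReal.ofReal (G z.1))) with hI2
  have hI1m : ∀ ε j, AEMeasurable (I1 ε j) (volume.prod volume) := fun ε j =>
    AEMeasurable.indicator ((hAm _ j G hGm).comp_fst.mul (hBm _ j F hFm).comp_snd)
      (measurableSet_idx_eq j)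
  have hI2m : ∀ ε j, AEMeasurable (I2 ε j) (volume.prod volume) := fun ε j =>
    AEMeasurable.indicator ((hAm _ j F hFm).comp_snd.mul (hBm _ j G hGm).comp_fst)
      (measurableSet_idx_eq j)
  have hjm : ∀ ε j, AEMeasurable (fun z => I1 ε j z + I2 ε j z) (volume.prod volume) :=
    fun ε j => (hI1m ε j).add (hI2m ε j)
  have hεm : ∀ ε, AEMeasurable (fun z => ∑ j ∈ Finset.range (2 * N + 2), (I1 ε j z + I2 ε j z))
      (volume.prod volume) := fun ε => Finset.aemeasurable_fun_sum _ fun j _ => hjm ε j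
  calc ∫⁻ z in R N, commIntegrand α b F G z ∂((volume : Measure E).prod volume)
      ≤ ∫⁻ z in R N, ENNReal.ofReal (6 ^ ((n : ℝ) - α)) * ∑ ε : Fin n → Bool,
        ∑ j ∈ Finset.range (2 * N + 2), (I1 ε j z + I2 ε j z)
          ∂((volume : Measure E).prod volume) :=
        setLIntegral_mono' (hRm N) fun z hz => commIntegrand_le hαn b hF hG hz.1 hz.2
    _ ≤ ∫⁻ z, ENNReal.ofReal (6 ^ ((n : ℝ) - α)) * ∑ ε : Fin n → Bool,
        ∑ j ∈ Finset.range (2 * N + 2), (I1 ε j z + I2 ε j z)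
          ∂((volume : Measure E).prod volume) := setLIntegral_le_lintegral _ _
    _ = ENNReal.ofReal (6 ^ ((n : ℝ) - α)) * ∑ ε : Fin n → Bool,
        ∑ j ∈ Finset.range (2 * N + 2),
          ((∫⁻ z, I1 ε j z ∂((volume : Measure E).prod volume)) +
            ∫⁻ z, I2 ε j z ∂((volume : Measure E).prod volume)) := by
        rw [lintegral_const_mul' _ _ ENNReal.ofReal_ne_top, lintegral_finsetSum' _ fun ε _ => hεm ε]
        congr 1
        refine Finset.sum_congr rfl fun ε _ => ?_
        rw [lintegral_finsetSum' _ fun j _ => hjm ε j]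
        refine Finset.sum_congr rfl fun j _ => ?_
        rw [lintegral_add_left' (hI1m ε j)]
    _ ≤ ENNReal.ofReal (6 ^ ((n : ℝ) - α)) * ∑ ε : Fin n → Bool, (C2 + C1) * (T * S) := by
        refine mul_le_mul_right (Finset.sum_le_sum fun ε _ => ?_) _
        rw [Finset.sum_add_distrib, add_mul]
        refine add_le_add ?_ ?_
        · have e : ∀ j, ∫⁻ z, I1 ε j z ∂((volume : Measure E).prod volume) = _ := fun j =>
            lintegral_prod_idx_eq (D := thirdGrid N ε) (hAm _ j G hGm) (hBm _ j F hFm) j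
          simp_rw [e]
          rw [hsum _ G F hGm hFm]
          -- Here the oscillation sits on `G` and `F` is averaged, so the roles of the two functions
          -- are exchanged.
          refine (hC2 (thirdGrid N ε) b v w g h T hA.symm (2 * N + 2)).trans (le_of_eq ?_)
          rw [hS]; ring
        · have e : ∀ j, ∫⁻ z, I2 ε j z ∂((volume : Measure E).prod volume) = _ := fun j =>
            lintegral_prod_idx_eq_symm (D := thirdGrid N ε) (hAm _ j F hFm) (hBm _ j G hGm) j
          simp_rw [e]
          rw [hsum _ F G hFm hGm]
          refine (hC1 (thirdGrid N ε) b w v h g T hA (2 * N + 2)).trans (le_of_eq ?_)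
          rw [hS]; ring
    _ = _ := by
        rw [Finset.sum_const, Finset.card_univ, nsmul_eq_mul, ← ENNReal.ofReal_rpow_of_pos (by norm_num)]
        push_cast
        rw [ENNReal.coe_rpow_of_ne_zero (by norm_num)]
        simp only [ENNReal.ofReal_ofNat, ENNReal.coe_ofNat]
        ring

/-! ### Duality, weights and normalization -/

/-- Testing against `φ' ^ (1/q')`, for a simple `φ' ≤ Z ^ q` with finite integral `I`, gives `I ≤ A
* I ^ (1/q')`, and `I` can be divided out. Approximation from below requires neither measurability
of `Z` nor finiteness of its norm. -/
theorem rpow_lintegral_le_of_forall_lintegral_mul_le {q q' : ℝ} (hqq : q.HolderConjugate q')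
    {Z : E → ℝ≥0∞} {A : ℝ≥0∞}
    (H : ∀ g : E → ℝ, Measurable g → (∀ x, 0 ≤ g x) → ∫⁻ x, ‖g x‖ₑ ^ q' ≠ ∞ →
      ∫⁻ x, Z x * ENNReal.ofReal (g x) ≤ A * (∫⁻ x, ‖g x‖ₑ ^ q') ^ (1 / q')) :
    (∫⁻ x, Z x ^ q) ^ (1 / q) ≤ A := by
  have hq0 : 0 < q := hqq.pos
  have hq'0 : 0 < q' := hqq.symm.pos
  rw [one_div, ENNReal.rpow_inv_le_iff hq0]
  refine le_of_forall_lt_imp_le_of_dense fun c hc => ?_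
  rw [lintegral_eq_nnreal] at hc
  simp only [lt_iSup_iff] at hc
  obtain ⟨φ, hφ, hcφ⟩ := hc
  rw [← SimpleFunc.lintegral_eq_lintegral] at hcφ
  have hcφ' : c < (∫⁻ x, φ x : ℝ≥0∞) := by simpa using hcφ
  obtain ⟨φ', hφ'1, hφ'2, hφ'3⟩ := SimpleFunc.exists_lt_lintegral_simpleFunc_of_lt_lintegral hcφ'
  set I : ℝ≥0∞ := ∫⁻ x, φ' x with hI
  refine hφ'3.le.trans ?_
  rcases eq_or_ne I 0 with hI0 | hI0
  · rw [hI0]; exact zero_le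
  have hg : ∀ x, ENNReal.ofReal ((φ' x : ℝ) ^ (1 / q')) = (φ' x : ℝ≥0∞) ^ (1 / q') := fun x => by
    rw [← ENNReal.ofReal_rpow_of_nonneg (φ' x).coe_nonneg (by positivity), ENNReal.ofReal_coe_nnreal]
  have hgn : ∫⁻ x, ‖(φ' x : ℝ) ^ (1 / q')‖ₑ ^ q' = I := by
    refine lintegral_congr fun x => ?_
    rw [Real.enorm_of_nonneg (by positivity), hg, ← ENNReal.rpow_mul, one_div_mul_cancel hq'0.ne',
      ENNReal.rpow_one]
  have h1 := H (fun x => (φ' x : ℝ) ^ (1 / q'))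
    ((φ'.measurable.coe_nnreal_real).pow_const _) (fun x => by positivity)
    (by rw [hgn]; exact hφ'2.ne)
  rw [hgn] at h1
  have h2 : I ≤ A * I ^ (1 / q') := by
    refine le_trans (lintegral_mono fun x => ?_) h1
    change (φ' x : ℝ≥0∞) ≤ Z x * ENNReal.ofReal ((φ' x : ℝ) ^ (1 / q'))
    rw [hg]
    have e1 : (φ' x : ℝ≥0∞) = (φ' x : ℝ≥0∞) ^ (1 / q) * (φ' x : ℝ≥0∞) ^ (1 / q') := by
      rw [← ENNReal.rpow_add_of_nonneg _ _ (by positivity) (by positivity), one_div, one_div,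
        hqq.inv_add_inv_eq_one, ENNReal.rpow_one]
    have e2 : (φ' x : ℝ≥0∞) ^ (1 / q) ≤ Z x := by
      rw [one_div, ENNReal.rpow_inv_le_iff hq0]
      exact (ENNReal.coe_le_coe.2 (hφ'1 x)).trans (hφ x)
    calc (φ' x : ℝ≥0∞) = (φ' x : ℝ≥0∞) ^ (1 / q) * (φ' x : ℝ≥0∞) ^ (1 / q') := e1
      _ ≤ _ := by gcongr
  have hIt : I ≠ ∞ := hφ'2.ne
  have e : I = I ^ (1 / q) * I ^ (1 / q') := by
    rw [← ENNReal.rpow_add_of_nonneg _ _ (by positivity) (by positivity), one_div, one_div,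
      hqq.inv_add_inv_eq_one, ENNReal.rpow_one]
  have h3 : I ^ (1 / q) * I ^ (1 / q') ≤ A * I ^ (1 / q') := by rwa [← e]
  have h4 : I ^ (1 / q) ≤ A := by
    refine (ENNReal.mul_le_mul_iff_left ?_ ?_).1 h3
    · rw [Ne, ENNReal.rpow_eq_zero_iff]
      rintro (⟨h, -⟩ | ⟨h, -⟩)
      · exact hI0 h
      · exact hIt h
    · exact ENNReal.rpow_ne_top_of_nonneg (by positivity) hIt
  rwa [one_div, ENNReal.rpow_inv_le_iff hq0] at h4

theorem lintegral_weightMeasure {w : E → ℝ} (hw : IsWeight w) (φ : E → ℝ≥0∞) :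
    ∫⁻ x, φ x ∂(weightMeasure w) = ∫⁻ x, ENNReal.ofReal (w x) * φ x :=
  lintegral_withDensity_eq_lintegral_mul_non_measurable₀ _ hw.aemeasurable.ennreal_ofReal
    (Filter.Eventually.of_forall fun _ => ENNReal.ofReal_lt_top) φ

/-- Only `f σ` is Lebesgue measurable up to null sets: `f` itself is unrestricted where `σ`
vanishes. -/
theorem aemeasurable_mul_weight {w f : E → ℝ} (hw : IsWeight w)
    (hf : AEMeasurable f (weightMeasure w)) : AEMeasurable (fun x => f x * w x) := by
  obtain ⟨w', hw'm, hw'⟩ := hw.aemeasurable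
  have e : weightMeasure w = volume.withDensity fun x => ((w' x).toNNReal : ℝ≥0∞) :=
    withDensity_congr_ae (hw'.mono fun x hx => by
      change ENNReal.ofReal (w x) = ENNReal.ofReal (w' x)
      rw [hx])
  rw [e, aemeasurable_withDensity_iff hw'm.real_toNNReal] at hf
  refine hf.congr (hw'.mono fun x hx => ?_)
  have : 0 ≤ w' x := hx ▸ hw.nonneg x
  simp only [smul_eq_mul, Real.coe_toNNReal _ this]
  rw [hx, mul_comm]

theorem eLpNorm_weightMeasure {w f : E → ℝ} (hw : IsWeight w) {p : ℝ} (hp : 0 < p) :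
    eLpNorm f (ENNReal.ofReal p) (weightMeasure w) =
      (∫⁻ x, ‖|f x| * w x ^ (1 / p)‖ₑ ^ p) ^ (1 / p) := by
  rw [eLpNorm_eq_lintegral_rpow_enorm_toReal (by simpa using hp) ENNReal.ofReal_ne_top,
    ENNReal.toReal_ofReal hp.le, lintegral_weightMeasure hw]
  congr 1
  refine lintegral_congr fun x => ?_
  have h1 : 0 ≤ w x ^ (1 / p) := Real.rpow_nonneg (hw.nonneg x) _
  rw [enorm_mul, ENNReal.mul_rpow_of_nonneg _ _ hp.le, Real.enorm_of_nonneg h1,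
    ENNReal.ofReal_rpow_of_nonneg h1 hp.le, ← Real.rpow_mul (hw.nonneg x),
    one_div_mul_cancel hp.ne', Real.rpow_one, mul_comm, Real.enorm_abs]

theorem bmoNorm_div_le_one {b : E → ℝ} {κ : ℝ} (hκ : 0 < κ)
    (h : bmoNorm b ≤ ENNReal.ofReal κ) : bmoNorm (fun x => b x / κ) ≤ 1 := by
  refine iSup_le fun a => iSup_le fun l => iSup_le fun hl => ?_
  have h1 : ⨍⁻ x in cube a l, ‖b x - ⨍ y in cube a l, b y ∂volume‖ₑ ∂volume ≤
      ENNReal.ofReal κ := by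
    refine le_trans ?_ h
    refine le_iSup_of_le a (le_iSup_of_le l ?_)
    exact le_iSup (fun _ : 0 < l => ⨍⁻ x in cube a l,
      ‖b x - ⨍ y in cube a l, b y ∂volume‖ₑ ∂volume) hl
  have e : ∀ x, ‖b x / κ - ⨍ y in cube a l, b y / κ ∂volume‖ₑ =
      ENNReal.ofReal κ⁻¹ * ‖b x - ⨍ y in cube a l, b y ∂volume‖ₑ := fun x => by
    rw [← Real.enorm_of_nonneg (inv_nonneg.2 hκ.le), ← enorm_mul]
    congr 1
    simp only [setAverage_eq, smul_eq_mul, integral_div]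
    ring
  simp_rw [e]
  rw [setLAverage_eq] at h1 ⊢
  rw [lintegral_const_mul' _ _ ENNReal.ofReal_ne_top, mul_div_assoc]
  calc _ ≤ ENNReal.ofReal κ⁻¹ * ENNReal.ofReal κ := by gcongr
    _ = 1 := by rw [← ENNReal.ofReal_mul (by positivity), inv_mul_cancel₀ hκ.ne', ENNReal.ofReal_one]

/-! ### The positive majorant and the commutator -/

/-- The positive operator that dominates the fractional integral and its commutator. -/
def commMajorant (α : ℝ) (b F : E → ℝ) (x : E) : ℝ≥0∞ :=
  ∫⁻ y, ENNReal.ofReal ((1 + |b x - b y|) * F y * (1 / ‖x - y‖ ^ ((n : ℝ) - α)))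

theorem exists_lintegral_commMajorant_le {α p q δ : ℝ} (hα : 0 < α) (hαn : α < n) (hp : 1 < p)
    (hpq : p ≤ q) (hδ : 0 < δ) :
    ∃ C : ℝ≥0, ∀ b u σ : E → ℝ, LocallyIntegrable b → bmoNorm b ≤ 1 → IsWeight u → IsWeight σ →
      bumpConst α p q (logBump q δ) (logBump (Real.conjExponent p) δ) u σ < ∞ →
      ∀ f : E → ℝ, MemLp f (ENNReal.ofReal p) (weightMeasure σ) →
        (∫⁻ x, commMajorant α b (fun y => |f y * σ y|) x ^ q ∂(weightMeasure u)) ^ (1 / q) ≤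
          C * bumpConst α p q (logBump q δ) (logBump (Real.conjExponent p) δ) u σ *
            eLpNorm f (ENNReal.ofReal p) (weightMeasure σ) := by
  have hp0 : 0 < p := by linarith
  have hq : 1 < q := by linarith
  have hq0 : 0 < q := by linarith
  have hpp := Real.HolderConjugate.conjExponent hp
  have hqq := Real.HolderConjugate.conjExponent hq
  set s := Real.conjExponent q with hs
  have hss : Real.conjExponent s = q := hqq.symm.conjExponent_eq
  have h1s : 1 / s = 1 - 1 / q := by
    have := hqq.inv_add_inv_eq_one
    rw [one_div, one_div]
    linarith
  have hpq' : 1 / q ≤ 1 / p := one_div_le_one_div_of_le hp0 hpq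
  obtain ⟨C, hC⟩ := exists_lintegral_commIntegrand_le (n := n) hα hαn hp hqq.symm.lt hδ
    (by rw [h1s]; linarith)
  refine ⟨C, fun b u σ hb hbmo hu hσ hT f hf => ?_⟩
  set T := bumpConst α p q (logBump q δ) (logBump (Real.conjExponent p) δ) u σ with hTdef
  have hfm := aemeasurable_mul_weight hσ hf.aestronglyMeasurable.aemeasurable
  have hbm := hb.aestronglyMeasurable.aemeasurable
  -- Measurability is obtained from `|f σ| σ^(1/p - 1)`; where `σ = 0` both expressions vanish.
  have hhm : AEMeasurable fun x => |f x| * σ x ^ (1 / p) := by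
    refine ((continuous_abs.measurable.comp_aemeasurable hfm).mul
      (hσ.aemeasurable.pow_const (1 / p - 1))).congr (Filter.Eventually.of_forall fun x => ?_)
    change |f x * σ x| * σ x ^ (1 / p - 1) = |f x| * σ x ^ (1 / p)
    rcases (hσ.nonneg x).eq_or_lt with h0 | h0
    · rw [← h0, Real.zero_rpow (one_div_pos.2 hp0).ne']
      simp
    · rw [abs_mul, abs_of_pos h0, mul_assoc, Real.rpow_sub h0, Real.rpow_one,
        mul_div_cancel₀ _ h0.ne']
  have hfin : ∫⁻ x, ‖|f x| * σ x ^ (1 / p)‖ₑ ^ p ≠ ∞ := by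
    have h2 := hf.eLpNorm_ne_top
    rw [eLpNorm_weightMeasure hσ hp0] at h2
    intro h3
    rw [h3, ENNReal.top_rpow_of_pos (by positivity)] at h2
    exact h2 rfl
  have hFeq : ∀ y, |f y| * σ y ^ (1 / p) * σ y ^ (1 / Real.conjExponent p) = |f y * σ y| := by
    intro y
    rw [mul_assoc, ← Real.rpow_add_of_nonneg (hσ.nonneg y) (by positivity)
      (one_div_nonneg.2 hpp.symm.nonneg), one_div, one_div, hpp.inv_add_inv_eq_one, Real.rpow_one,
      abs_mul, abs_of_nonneg (hσ.nonneg y)]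
  have key := rpow_lintegral_le_of_forall_lintegral_mul_le hqq
    (Z := fun x => commMajorant α b (fun y => |f y * σ y|) x * ENNReal.ofReal (u x ^ (1 / q)))
    (A := C * T * eLpNorm f (ENNReal.ofReal p) (weightMeasure σ)) ?_
  · refine le_trans (le_of_eq ?_) key
    rw [lintegral_weightMeasure hu]
    congr 1
    refine lintegral_congr fun x => ?_
    have h1 : 0 ≤ u x ^ (1 / q) := Real.rpow_nonneg (hu.nonneg x) _
    rw [ENNReal.mul_rpow_of_nonneg _ _ hq0.le, ENNReal.ofReal_rpow_of_nonneg h1 hq0.le,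
      ← Real.rpow_mul (hu.nonneg x), one_div_mul_cancel hq0.ne', Real.rpow_one, mul_comm]
  · intro g hgm hg0 hgfin
    have hA : Admissible α p s δ b (fun x => σ x ^ (1 / Real.conjExponent p))
        (fun x => u x ^ (1 / q)) (fun x => |f x| * σ x ^ (1 / p)) g T :=
      { locallyIntegrable := hb
        bmoNorm_le := hbmo
        aemeasurable_w := hσ.aemeasurable.pow_const _
        aemeasurable_v := hu.aemeasurable.pow_const _
        aemeasurable_h := hhm
        aemeasurable_g := hgm.aemeasurable
        w_nonneg := fun x => Real.rpow_nonneg (hσ.nonneg x) _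
        v_nonneg := fun x => Real.rpow_nonneg (hu.nonneg x) _
        h_nonneg := fun x => mul_nonneg (abs_nonneg _) (Real.rpow_nonneg (hσ.nonneg x) _)
        g_nonneg := hg0
        ne_top := hT.ne
        bump_le := fun a l hl => by
          rw [hss, show α / n + 1 - 1 / p - 1 / s = α / n + 1 / q - 1 / p by rw [h1s]; ring]
          refine le_iSup_of_le a (le_iSup_of_le l ?_)
          exact le_iSup (fun _ : 0 < l => volume (cube a l) ^ (α / n + 1 / q - 1 / p) *
            luxNorm (logBump q δ) (cube a l) (fun x => u x ^ (1 / q)) *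
            luxNorm (logBump (Real.conjExponent p) δ) (cube a l)
              (fun x => σ x ^ (1 / Real.conjExponent p))) hl
        h_lt_top := hfin
        g_lt_top := hgfin }
    have h2 := hC _ _ _ _ _ _ hA
    rw [eLpNorm_weightMeasure hσ hp0, mul_assoc (C * T : ℝ≥0∞)]
    refine le_trans (le_of_eq ?_) h2
    have hm1 : AEMeasurable fun x => |f x| * σ x ^ (1 / p) * σ x ^ (1 / Real.conjExponent p) :=
      hhm.mul (hσ.aemeasurable.pow_const _)
    have hm2 : AEMeasurable fun x => g x * u x ^ (1 / q) :=
      hgm.aemeasurable.mul (hu.aemeasurable.pow_const _)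
    rw [lintegral_prod _ (aemeasurable_commIntegrand α hbm hm1 hm2)]
    refine lintegral_congr fun x => ?_
    have hux : 0 ≤ u x ^ (1 / q) := Real.rpow_nonneg (hu.nonneg x) _
    rw [mul_assoc, ← ENNReal.ofReal_mul hux, commMajorant,
      ← lintegral_mul_const' _ _ ENNReal.ofReal_ne_top]
    refine lintegral_congr fun y => ?_
    have hd : 0 ≤ 1 / ‖x - y‖ ^ ((n : ℝ) - α) := by positivity
    rw [commIntegrand, ← ENNReal.ofReal_mul (by positivity), hFeq]
    congr 1
    ring

/-- The multiplier `c` will be `1`, `b`, or `b x - b`, with `M` equal to `1`, `|b x| + κ`, or `κ`.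
-/
theorem enorm_fracIntegrand_le {α κ : ℝ} {b F : E → ℝ} {x : E}
    {c : E → ℝ} {M : ℝ}
    (hc : ∀ y, |c y| ≤ M * (1 + |b x / κ - b y / κ|)) (y : E) :
    ‖fracIntegrand α (fun y => c y * F y) x y‖ₑ ≤ ENNReal.ofReal M *
      ENNReal.ofReal ((1 + |b x / κ - b y / κ|) * |F y| * (1 / ‖x - y‖ ^ ((n : ℝ) - α))) := by
  have hd : 0 ≤ 1 / ‖x - y‖ ^ ((n : ℝ) - α) := by positivity
  rw [← ENNReal.ofReal_mul' (by positivity), Real.enorm_eq_ofReal_abs]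
  refine ENNReal.ofReal_le_ofReal ?_
  rw [fracIntegrand, div_eq_mul_one_div, abs_mul, abs_mul, abs_of_nonneg hd]
  calc _ ≤ M * (1 + |b x / κ - b y / κ|) * |F y| * (1 / ‖x - y‖ ^ ((n : ℝ) - α)) := by
        gcongr
        exact hc y
    _ = _ := by ring

theorem lintegral_enorm_fracIntegrand_le {α κ : ℝ} {b F : E → ℝ} {x : E}
    {c : E → ℝ} {M : ℝ}
    (hc : ∀ y, |c y| ≤ M * (1 + |b x / κ - b y / κ|)) :
    ∫⁻ y, ‖fracIntegrand α (fun y => c y * F y) x y‖ₑ ≤ ENNReal.ofReal M *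
      commMajorant α (fun y => b y / κ) (fun y => |F y|) x := by
  rw [commMajorant, ← lintegral_const_mul' _ _ ENNReal.ofReal_ne_top]
  exact lintegral_mono fun y => enorm_fracIntegrand_le hc y

theorem integrable_fracIntegrand {α κ : ℝ} {b F : E → ℝ} {x : E}
    (hF : AEMeasurable F) {c : E → ℝ}
    (hcm : AEMeasurable c) {M : ℝ} (hc : ∀ y, |c y| ≤ M * (1 + |b x / κ - b y / κ|))
    (hfin : commMajorant α (fun y => b y / κ) (fun y => |F y|) x ≠ ∞) :
    Integrable (fracIntegrand α (fun y => c y * F y) x) := by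
  refine ⟨?_, (lintegral_enorm_fracIntegrand_le hc).trans_lt
    (ENNReal.mul_lt_top ENNReal.ofReal_lt_top hfin.lt_top)⟩
  have h2 : Measurable fun y : E => ‖x - y‖ ^ ((n : ℝ) - α) := by fun_prop
  exact ((hcm.mul hF).div h2.aemeasurable).aestronglyMeasurable

theorem integrable_fracIntegrand_of_commMajorant_ne_top {α κ : ℝ} {b F : E → ℝ} {x : E}
    (hF : AEMeasurable F)
    (hfin : commMajorant α (fun y => b y / κ) (fun y => |F y|) x ≠ ∞) :
    Integrable (fracIntegrand α F x) := by
  have := integrable_fracIntegrand (c := fun _ => 1) (M := 1) hF aemeasurable_const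
    (fun y => by simp) hfin
  simpa using this

theorem integrable_fracIntegrand_mul_of_commMajorant_ne_top {α κ : ℝ} {b F : E → ℝ} {x : E}
    (hκ : 0 < κ) (hF : AEMeasurable F)
    (hb : AEMeasurable b)
    (hfin : commMajorant α (fun y => b y / κ) (fun y => |F y|) x ≠ ∞) :
    Integrable (fracIntegrand α (fun y => b y * F y) x) := by
  refine integrable_fracIntegrand (M := |b x| + κ) hF hb (fun y => ?_) hfin
  have h1 : |b x - b y| = κ * |b x / κ - b y / κ| := by
    rw [← sub_div, abs_div, abs_of_pos hκ]
    field_simp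
  have h2 : |b y| ≤ |b x| + |b x - b y| := by
    have := abs_sub_abs_le_abs_sub (b y) (b x)
    rw [abs_sub_comm] at this
    linarith
  have h3 : 0 ≤ |b x| * |b x / κ - b y / κ| := by positivity
  nlinarith

theorem enorm_commutator_le {α κ : ℝ} {b F : E → ℝ} {x : E}
    (hκ : 0 < κ) (hF : AEMeasurable F) (hb : AEMeasurable b)
    (hfin : commMajorant α (fun y => b y / κ) (fun y => |F y|) x ≠ ∞) :
    ‖commutator b α F x‖ₑ ≤ ENNReal.ofReal κ *
      commMajorant α (fun y => b y / κ) (fun y => |F y|) x := by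
  have h1 := integrable_fracIntegrand_of_commMajorant_ne_top hF hfin
  have h2 := integrable_fracIntegrand_mul_of_commMajorant_ne_top hκ hF hb hfin
  have e : commutator b α F x = ∫ y, fracIntegrand α (fun y => (b x - b y) * F y) x y := by
    rw [commutator, fracIntegral, fracIntegral, ← integral_const_mul,
      ← integral_sub (h1.const_mul _) h2]
    refine integral_congr_ae (Filter.Eventually.of_forall fun y => ?_)
    simp only [fracIntegrand]
    ring
  rw [e]
  refine (enorm_integral_le_lintegral_enorm _).trans
    (lintegral_enorm_fracIntegrand_le fun y => ?_)
  have h1 : |b x - b y| = κ * |b x / κ - b y / κ| := by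
    rw [← sub_div, abs_div, abs_of_pos hκ]
    field_simp
  rw [h1]
  gcongr
  linarith

theorem aestronglyMeasurable_fracIntegral (α : ℝ) {F : E → ℝ} (hF : AEMeasurable F) :
    AEStronglyMeasurable (fracIntegral α F) := by
  have h2 : Measurable fun z : E × E => ‖z.1 - z.2‖ ^ ((n : ℝ) - α) := by fun_prop
  exact AEStronglyMeasurable.integral_prod_right' (f := fun z => fracIntegrand α F z.1 z.2)
    (hF.comp_snd.div h2.aemeasurable).aestronglyMeasurable

theorem aemeasurable_commMajorant (α : ℝ) {b F : E → ℝ} (hb : AEMeasurable b)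
    (hF : AEMeasurable F) : AEMeasurable (commMajorant α b F) := by
  have := aemeasurable_commIntegrand α hb hF (aemeasurable_const (b := (1 : ℝ)))
  refine AEMeasurable.congr this.lintegral_prod_right' (Filter.Eventually.of_forall fun x => ?_)
  simp only [commIntegrand, commMajorant, mul_one]

end FracComm

end

/-! ### The two-weight bound -/

theorem mainTheorem5 (n : ℕ) (α p q δ : ℝ) (hα : 0 < α) (hαn : α < n)
    (hp : 1 < p) (hpq : p ≤ q) (hδ : 0 < δ) :
    ∃ C : ℝ≥0, ∀ b u σ : EuclideanSpace ℝ (Fin n) → ℝ,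
      FracComm.IsBMO b → FracComm.IsWeight u → FracComm.IsWeight σ →
      FracComm.bumpConst α p q (FracComm.logBump q δ)
        (FracComm.logBump (Real.conjExponent p) δ) u σ < ∞ →
      ∀ f : EuclideanSpace ℝ (Fin n) → ℝ,
        MemLp f (ENNReal.ofReal p) (FracComm.weightMeasure σ) →
        (∀ᵐ x ∂(FracComm.weightMeasure u),
          Integrable (FracComm.fracIntegrand α (fun y => f y * σ y) x) volume ∧
          Integrable (FracComm.fracIntegrand α (fun y => b y * (f y * σ y)) x) volume) ∧
        MemLp (FracComm.commutator b α (fun y => f y * σ y)) (ENNReal.ofReal q)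
          (FracComm.weightMeasure u) ∧
        eLpNorm (FracComm.commutator b α (fun y => f y * σ y)) (ENNReal.ofReal q)
            (FracComm.weightMeasure u) ≤
          C * FracComm.bmoNorm b *
            FracComm.bumpConst α p q (FracComm.logBump q δ)
              (FracComm.logBump (Real.conjExponent p) δ) u σ *
            eLpNorm f (ENNReal.ofReal p) (FracComm.weightMeasure σ) := by
  obtain ⟨C, hC⟩ := FracComm.exists_lintegral_commMajorant_le hα hαn hp hpq hδ
  refine ⟨C, fun b u σ hb hu hσ hT f hf => ?_⟩
  have hq0 : 0 < q := by linarith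
  have hac : FracComm.weightMeasure u ≪ volume := withDensity_absolutelyContinuous _ _
  have hFm := FracComm.aemeasurable_mul_weight hσ hf.aestronglyMeasurable.aemeasurable
  have hbm := hb.locallyIntegrable.aestronglyMeasurable.aemeasurable
  set T := FracComm.bumpConst α p q (FracComm.logBump q δ)
    (FracComm.logBump (Real.conjExponent p) δ) u σ with hTdef
  set S := C * T * eLpNorm f (ENNReal.ofReal p) (FracComm.weightMeasure σ) with hS
  have hSt : S ≠ ∞ := ENNReal.mul_ne_top (ENNReal.mul_ne_top ENNReal.coe_ne_top hT.ne)
    hf.eLpNorm_ne_top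
  -- Dividing `b` by any positive `κ ≥ ‖b‖_BMO` normalizes it; `κ` stays free because the norm
  -- itself may be zero.
  set U : ℝ → EuclideanSpace ℝ (Fin n) → ℝ≥0∞ := fun κ =>
    FracComm.commMajorant α (fun y => b y / κ) (fun y => |f y * σ y|) with hU
  have hUS : ∀ κ : ℝ, 0 < κ → FracComm.bmoNorm b ≤ ENNReal.ofReal κ →
      (∫⁻ x, U κ x ^ q ∂(FracComm.weightMeasure u)) ^ (1 / q) ≤ S := fun κ hκ hbκ =>
    hC (fun x => b x / κ) u σ (by
      have := hb.locallyIntegrable.smul κ⁻¹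
      simp only [div_eq_inv_mul]
      exact this)
      (FracComm.bmoNorm_div_le_one hκ hbκ) hu hσ hT f hf
  have hUfin : ∀ κ : ℝ, 0 < κ → FracComm.bmoNorm b ≤ ENNReal.ofReal κ →
      ∀ᵐ x ∂(FracComm.weightMeasure u), U κ x ≠ ∞ := fun κ hκ hbκ => by
    have hm : AEMeasurable (U κ) (FracComm.weightMeasure u) :=
      (FracComm.aemeasurable_commMajorant α (hbm.div_const κ)
        (continuous_abs.measurable.comp_aemeasurable hFm)).mono_ac hac
    have hlt : ∫⁻ x, U κ x ^ q ∂(FracComm.weightMeasure u) ≠ ∞ := fun htop => by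
      have := hUS κ hκ hbκ
      rw [htop, ENNReal.top_rpow_of_pos (by positivity)] at this
      exact hSt (top_le_iff.1 this)
    filter_upwards [ae_lt_top' (hm.pow_const q) hlt] with x hx htop
    rw [htop, ENNReal.top_rpow_of_pos hq0] at hx
    exact lt_irrefl _ hx
  have hnorm : ∀ κ : ℝ, 0 < κ → FracComm.bmoNorm b ≤ ENNReal.ofReal κ →
      eLpNorm (FracComm.commutator b α (fun y => f y * σ y)) (ENNReal.ofReal q)
        (FracComm.weightMeasure u) ≤ ENNReal.ofReal κ * S := fun κ hκ hbκ => by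
    rw [eLpNorm_eq_lintegral_rpow_enorm_toReal (by simpa using hq0) ENNReal.ofReal_ne_top,
      ENNReal.toReal_ofReal hq0.le]
    calc _ ≤ (∫⁻ x, (ENNReal.ofReal κ * U κ x) ^ q ∂(FracComm.weightMeasure u)) ^ (1 / q) := by
          refine ENNReal.rpow_le_rpow (lintegral_mono_ae ?_) (by positivity)
          filter_upwards [hUfin κ hκ hbκ] with x hx
          exact ENNReal.rpow_le_rpow (FracComm.enorm_commutator_le hκ hFm hbm hx) hq0.le
      _ = ENNReal.ofReal κ * (∫⁻ x, U κ x ^ q ∂(FracComm.weightMeasure u)) ^ (1 / q) := by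
          simp_rw [ENNReal.mul_rpow_of_nonneg _ _ hq0.le]
          rw [lintegral_const_mul' _ _ (ENNReal.rpow_ne_top_of_nonneg hq0.le
            ENNReal.ofReal_ne_top), ENNReal.mul_rpow_of_nonneg _ _ (by positivity),
            ← ENNReal.rpow_mul, mul_one_div_cancel hq0.ne', ENNReal.rpow_one]
      _ ≤ _ := mul_le_mul_right (hUS κ hκ hbκ) _
  set β := (FracComm.bmoNorm b).toReal with hβ
  have hβ0 : 0 ≤ β := ENNReal.toReal_nonneg
  have hββ : FracComm.bmoNorm b = ENNReal.ofReal β :=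
    (ENNReal.ofReal_toReal hb.bmoNorm_lt_top.ne).symm
  have hκ1 : FracComm.bmoNorm b ≤ ENNReal.ofReal (β + 1) := by
    rw [hββ]
    exact ENNReal.ofReal_le_ofReal (by linarith)
  have hβ1 : 0 < β + 1 := by linarith
  refine ⟨?_, ⟨?_, ?_⟩, ?_⟩
  · filter_upwards [hUfin (β + 1) hβ1 hκ1] with x hx
    exact ⟨FracComm.integrable_fracIntegrand_of_commMajorant_ne_top hFm hx,
      FracComm.integrable_fracIntegrand_mul_of_commMajorant_ne_top hβ1 hFm hbm hx⟩
  · refine AEStronglyMeasurable.mono_ac hac ?_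
    exact (hbm.aestronglyMeasurable.mul (FracComm.aestronglyMeasurable_fracIntegral α hFm)).sub
      (FracComm.aestronglyMeasurable_fracIntegral α (hbm.mul hFm))
  · exact (hnorm (β + 1) hβ1 hκ1).trans_lt (ENNReal.mul_lt_top ENNReal.ofReal_lt_top hSt.lt_top)
  -- Letting `κ = β + ε` decrease to `β` gives the sharp factor `‖b‖_BMO`, also when it is zero.
  · have hlim : Filter.Tendsto (fun ε : ℝ => ENNReal.ofReal (β + ε) * S)
        (nhdsWithin 0 (Set.Ioi 0)) (nhds (ENNReal.ofReal (β + 0) * S)) := by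
      refine ENNReal.Tendsto.mul_const ?_ (Or.inr hSt)
      refine (ENNReal.continuous_ofReal.tendsto _).comp ?_
      exact (tendsto_const_nhds.add Filter.tendsto_id).mono_left nhdsWithin_le_nhds
    have h := ge_of_tendsto hlim (Filter.eventually_of_mem self_mem_nhdsWithin
      fun ε (hε : 0 < ε) => hnorm (β + ε) (by linarith) (by
        rw [hββ]
        exact ENNReal.ofReal_le_ofReal (by linarith)))
    rw [add_zero, ← hββ] at h
    refine h.trans (le_of_eq ?_)
    rw [hS]
    ring
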